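/- There is a universal constant $K>0$ such that the following holds. Let $X\subset\mathbb{R}^d$ be a finite set, let $\gamma>0$, and let $S_C$ be a finite set of points. Then there is a deterministic algorithm that depends only on $X$, $\gamma$ and $S_C$, that adaptively asks same-cluster queries $\mathrm{scq}(x,x')$ with $x,x'\in X$ (each query reveals whether $x$ and $x'$ lie in the same cluster), and that has the following property. Let $\mathcal C$ be any latent clustering (partition) of $X$ and let $C\in\mathcal C$ be any cluster with $S_C\subseteq C$ that has margin $\gamma$, that is, there are a positive semidefinite matrix $W\in\mathbb{R}^{d\times d}$ and a point $c\in\mathbb{R}^d$ such that $d_W(y,c)>\sqrt{1+\gamma}\,d_W(x,c)$ for all $x\in C$ and all $y\in X\setminus C$, where $d_W(u,v)=\sqrt{(u-v)^{\top}W(u-v)}$. Then the algorithm, run on the queries of $\mathcal C$, returns exactly the set $C\cap E_J(S_C)$ and asks at most $$\max\Big\{2^r,\ \Big(K\,\tfrac{r}{\gamma}\,\ln^{+}\tfrac{r}{\gamma}\Big)^{r}\Big\}$$ queries, where $r=\mathrm{rank}(C)$ is the dimension of the linear span of $C$, $\ln^+ t=\max\{0,\ln t\}$ for $t>0$ and $\ln^+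 0=0$ (and $0^0=1$), and $E_J(S_C)$ is the minimum-volume enclosing ellipsoid of $S_C$, i.e. the ellipsoid of smallest volume that contains $S_C$ among the ellipsoids in the affine hull of $S_C$ (volume and ellipsoids being taken in the dimension of that affine hull; $E_J(\emptyset)=\emptyset$). -/

import Mathlib

/-- The space `ℝ^d` with its Euclidean inner product. -/
abbrev Pt (d : ℕ) : Type := EuclideanSpace ℝ (Fin d)

/-- The pseudo-metric `d_W(x, y) = √((x - y)ᵀ W (x - y))` of a matrix `W`. -/
noncomputable def matDist {d : ℕ} (W : Matrix (Fin d) (Fin d) ℝ) (x y : Pt d) : ℝ :=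
  Real.sqrt ((x - y).ofLp ⬝ᵥ W.mulVec (x - y).ofLp)

/-- The cluster `C ⊆ X` has margin `γ`: for some positive semidefinite matrix `W` and some point
`c`, every input point outside `C` is more than `√(1 + γ)` times as far from `c` as every point
of `C`, in the pseudo-metric of `W`. -/
def HasMargin {d : ℕ} (X C : Finset (Pt d)) (γ : ℝ) : Prop :=
  ∃ (W : Matrix (Fin d) (Fin d) ℝ) (c : Pt d), W.PosSemidef ∧
    ∀ y ∈ X, y ∉ C → ∀ x ∈ C, Real.sqrt (1 + γ) * matDist W x c < matDist W y c

/-- The rank of a cluster: the dimension of the linear subspace spanned by its points. -/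
noncomputable def clusterRank {d : ℕ} (C : Finset (Pt d)) : ℕ :=
  Module.finrank ℝ (Submodule.span ℝ (C : Set (Pt d)))

/-- `M` is a positive definite operator on the subspace `V`. -/
def IsPosDefOn {d : ℕ} (V : Submodule ℝ (Pt d)) (M : V →ₗ[ℝ] V) : Prop :=
  M.IsSymmetric ∧ ∀ v : V, v ≠ 0 → 0 < inner ℝ v (M v)

/-- The ellipsoid `{v | ⟨v, M v⟩ ≤ 1}` of the subspace `V`, centred at the origin. -/
def centredEllipsoid {d : ℕ} (V : Submodule ℝ (Pt d)) (M : V →ₗ[ℝ] V) : Set V :=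
  {v : V | inner ℝ v (M v) ≤ 1}

/-- The translate of the ellipsoid of `M` with centre `m`, as a subset of `ℝ^d`. -/
def ellipsoidAt {d : ℕ} (V : Submodule ℝ (Pt d)) (m : Pt d) (M : V →ₗ[ℝ] V) : Set (Pt d) :=
  (fun v : V => m + (v : Pt d)) '' centredEllipsoid V M

/-- Lebesgue measure of a subspace `V`, normalised by the unit cubes of orthonormal bases of `V`
(this is not the restriction of the Lebesgue measure of `ℝ^d`). -/
noncomputable def subspaceVolume {d : ℕ} (V : Submodule ℝ (Pt d)) : MeasureTheory.Measure V :=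
  (stdOrthonormalBasis ℝ V).toBasis.addHaar

/-- `E` is a minimum-volume enclosing ellipsoid of `S`: among all (full-dimensional) ellipsoids
of the affine hull of `S` that contain `S`, it has the smallest volume. -/
def IsMVEE {d : ℕ} (S E : Set (Pt d)) : Prop :=
  ∃ m ∈ affineSpan ℝ S, ∃ M : (affineSpan ℝ S).direction →ₗ[ℝ] (affineSpan ℝ S).direction,
    IsPosDefOn (affineSpan ℝ S).direction M ∧
    E = ellipsoidAt (affineSpan ℝ S).direction m M ∧
    S ⊆ E ∧
    ∀ m' ∈ affineSpan ℝ S,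
      ∀ M' : (affineSpan ℝ S).direction →ₗ[ℝ] (affineSpan ℝ S).direction,
        IsPosDefOn (affineSpan ℝ S).direction M' →
        S ⊆ ellipsoidAt (affineSpan ℝ S).direction m' M' →
        subspaceVolume (affineSpan ℝ S).direction
            (centredEllipsoid (affineSpan ℝ S).direction M) ≤
          subspaceVolume (affineSpan ℝ S).direction
            (centredEllipsoid (affineSpan ℝ S).direction M')

open Classical in
/-- The minimum-volume enclosing ellipsoid of `S`. For bounded nonempty `S` it exists and is
unique; for `S = ∅` (which lies in no ellipsoid of its empty affine hull) it is empty. -/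
noncomputable def mvee {d : ℕ} (S : Set (Pt d)) : Set (Pt d) :=
  if h : ∃ E, IsMVEE S E then Classical.choose h else ∅

/-- A deterministic adaptive algorithm that asks queries about pairs of elements of `α`:
it either stops with an output, or asks one query and continues with the first algorithm if the
answer is `true`, with the second one if the answer is `false`. -/
inductive QueryAlg (α β : Type) : Type
  | output : β → QueryAlg α β
  | query : α → α → QueryAlg α β → QueryAlg α β → QueryAlg α β

/-- The output of a query algorithm run with a given oracle. -/
def QueryAlg.result {α β : Type} (oracle : α → α → Bool) : QueryAlg α β → β
  | .output b => b
  | .query x y t f => if oracle x y then t.result oracle else f.result oracle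

/-- The number of queries that a query algorithm asks when it is run with a given oracle. -/
def QueryAlg.numQueries {α β : Type} (oracle : α → α → Bool) : QueryAlg α β → ℕ
  | .output _ => 0
  | .query x y t f =>
      1 + (if oracle x y then t.numQueries oracle else f.numQueries oracle)

open Classical in
/-- A clustering of `X`: a partition of `X` into nonempty clusters. -/
abbrev Clustering {d : ℕ} (X : Finset (Pt d)) : Type := Finpartition X

open Classical in
/-- The same-cluster oracle of a clustering of `X`; only points of `X` may be queried. -/
noncomputable def scq {d : ℕ} (X : Finset (Pt d)) (P : Clustering X)
    (x y : {p : Pt d // p ∈ X}) : Bool :=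
  decide (∃ C ∈ P.parts, x.1 ∈ C ∧ y.1 ∈ C)

/-! A point outside a cluster `C` with margin `γ` is an *outlier* of `C`: the quadratic separation
by the matrix `W` implies, by the Cauchy-Schwarz inequality, that some affine functional `g`
satisfies `|g| ≤ 1` on `C` and takes the value `√(1 + γ)` at that point (`HasMargin.isOutlier`).
So points of `X` that are not outliers of `S` lie in `C`, and of two points `x`, `y` either both
or none lie in `C`, unless `y` is an outlier of `S ∪ {x}` or `x` is one of `S ∪ {y}`. The
algorithm takes a maximal set `T` of outliers of `S` in the ellipsoid that are pairwise related in
this way, compares all elements of `T` with a point of `S`, and gives every other outlier the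
answer of an element of `T` to which it is unrelated. The queries are not even adaptive, and what
has to be bounded is the number of elements of `T`.

Let `k ≤ r` be the dimension of the affine hull of `S`, with coordinates in which the ellipsoid is
the unit ball of `ℝᵏ`. Its minimality gives a dual form of John's theorem: if `g u = ⟨p, u⟩ + q`
has `|g| ≤ 1` on `S`, then `‖p‖² + k q² ≤ k` (`InJohnPosition.norm_sq_add_le`). In particular `g`
is `√k`-Lipschitz, the elements of `T` have distances at least `(√(1 + γ) - 1) / √k`, and volume
bounds their number by a power of `k / γ` (`card_le_pow_of_outliers`). This suffices as long
as `k / γ` stays away from `1`.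

If `γ` is nearly `k`, or larger, only `2 ^ k` queries are allowed. There the inequality
`1 + γ = g(y)² ≤ k ‖y‖² + 1` is nearly an equality, so that `g` is nearly determined by `y`, and
the lifts `(1, √k x) / √(k + 1)` of the elements of `T` to `ℝᵏ⁺¹` are nearly unit vectors with inner
products at most about `1 / √(k + 1)` in absolute value
(`InJohnPosition.abs_mul_inner_add_one_le`). For `k ≥ 15` a volume argument bounds their number by
`2 ^ k`. For `4 ≤ k ≤ 14` the trace-free parts of the projections onto these vectors live in a
space of dimension `k (k + 3) / 2`, and a rank argument gives at most `(k + 1) (k + 3) / 2`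
vectors, one of which may be taken to be the basis vector `(1, 0)`; for `k = 4` this is exactly
enough. For `k ≤ 2` the ball contains no outliers at all, and for `k = 3` the set `S` has a point
near `-y` for every outlier `y`, which makes the inner products of outliers so small that a rank
argument in `ℝ³` suffices. -/

/-! ### Query algorithms -/

/-- The algorithm that asks the queries `(s, t)` for all `t` in a list, regardless of the answers,
and then applies `out` to the sublist of those `t` that were answered positively. -/
def QueryAlg.askAll {α β : Type} (s : α) : List α → (List α → β) → QueryAlg α β
  | [], out => .output (out [])
  | t :: ts, out => .query s t (askAll s ts fun l => out (t :: l)) (askAll s ts out)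

theorem QueryAlg.result_askAll {α β : Type} (oracle : α → α → Bool) (s : α) (l : List α)
    (out : List α → β) :
    (askAll s l out).result oracle = out (l.filter (oracle s)) := by
  induction l generalizing out with
  | nil => simp [askAll, result]
  | cons t ts ih =>
    by_cases h : oracle s t <;> simp [askAll, result, h, ih]

theorem QueryAlg.numQueries_askAll {α β : Type} (oracle : α → α → Bool) (s : α) (l : List α)
    (out : List α → β) :
    (askAll s l out).numQueries oracle = l.length := by
  induction l generalizing out with
  | nil => simp [askAll, numQueries]
  | cons t ts ih => simp [askAll, numQueries, ih, add_comm]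

theorem scq_eq_true_iff {d : ℕ} {X : Finset (Pt d)} {P : Clustering X} {C : Finset (Pt d)}
    (hC : C ∈ P.parts) {x y : {p : Pt d // p ∈ X}} (hx : x.1 ∈ C) :
    scq X P x y = true ↔ y.1 ∈ C := by
  classical
  simp only [scq, decide_eq_true_eq]
  constructor
  · rintro ⟨D, hD, hxD, hyD⟩
    rwa [P.eq_of_mem_parts hC hD hx hxD]
  · exact fun hy => ⟨C, hC, hx, hy⟩

/-! ### Packing in the unit ball -/

section Packing

open MeasureTheory Metric

/-- A set of points of the unit ball of a `k`-dimensional space, at pairwise distance at least `δ`,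
has at most `2 (1 + 4 / δ²) ^ (k / 2)` elements: the halves of the balls of radius `δ / 2` around
these points that face the origin are disjoint, and they lie in the ball of radius `√(1 + δ² / 4)`. -/
theorem card_sq_le_of_separated {F : Type*} [NormedAddCommGroup F] [InnerProductSpace ℝ F]
    [FiniteDimensional ℝ F] [MeasurableSpace F] [BorelSpace F] {δ : ℝ} (hδ : 0 < δ)
    (T : Finset F) (hT : ∀ x ∈ T, ‖x‖ ≤ 1) (hsep : ∀ x ∈ T, ∀ y ∈ T, x ≠ y → δ ≤ dist x y) :
    (T.card : ℝ) ^ 2 ≤ 4 * (1 + 4 / δ ^ 2) ^ Module.finrank ℝ F := by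
  set μ : Measure F := volume
  set R : ℝ := √(1 + δ ^ 2 / 4) with hR
  have hR0 : 0 < R := Real.sqrt_pos.2 (by positivity)
  have hR2 : R ^ 2 = 1 + δ ^ 2 / 4 := Real.sq_sqrt (by positivity)
  -- the half balls around `x` on the side of the origin
  let H : F → Set F := fun x => ball x (δ / 2) ∩ {z | inner ℝ (z - x) x ≤ 0}
  have hmeas : ∀ x, MeasurableSet (H x) := fun x =>
    measurableSet_ball.inter (isClosed_le (by fun_prop) continuous_const).measurableSet
  have hhalf : ∀ x, μ (ball x (δ / 2)) ≤ 2 * μ (H x) := by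
    intro x
    have hpres : MeasurePreserving (fun z : F => (2 : ℝ) • x - z) μ μ :=
      Measure.measurePreserving_sub_left μ _
    have hcov : ball x (δ / 2) ⊆ H x ∪ (fun z : F => (2 : ℝ) • x - z) ⁻¹' H x := by
      intro z hz
      rcases le_total (inner ℝ (z - x) x) 0 with h | h
      · exact Or.inl ⟨hz, h⟩
      · refine Or.inr ⟨?_, ?_⟩
        · rw [mem_ball, dist_eq_norm] at hz ⊢
          rwa [show (2 : ℝ) • x - z - x = -(z - x) by rw [two_smul]; abel, norm_neg]
        · change inner ℝ ((2 : ℝ) • x - z - x) x ≤ 0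
          rw [show (2 : ℝ) • x - z - x = -(z - x) by rw [two_smul]; abel, inner_neg_left]
          linarith
    calc μ (ball x (δ / 2)) ≤ μ (H x) + μ ((fun z : F => (2 : ℝ) • x - z) ⁻¹' H x) :=
          (measure_mono hcov).trans (measure_union_le _ _)
      _ = 2 * μ (H x) := by
          rw [hpres.measure_preimage (hmeas x).nullMeasurableSet, two_mul]
  have hdisj : (T : Set F).PairwiseDisjoint H := by
    intro x hx y hy hxy
    refine Disjoint.mono Set.inter_subset_left Set.inter_subset_left (ball_disjoint_ball ?_)
    have := hsep x hx y hy hxy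
    linarith
  have hsub : (⋃ x ∈ T, H x) ⊆ closedBall (0 : F) R := by
    intro z hz
    simp only [Set.mem_iUnion] at hz
    obtain ⟨x, hx, hz1, hz2⟩ := hz
    rw [mem_closedBall, dist_zero_right]
    refine abs_le_of_sq_le_sq' ?_ hR0.le |>.2
    rw [mem_ball, dist_eq_norm] at hz1
    have hz2' : inner ℝ (z - x) x ≤ 0 := hz2
    have h1 : ‖z‖ ^ 2 = ‖z - x‖ ^ 2 + 2 * inner ℝ (z - x) x + ‖x‖ ^ 2 := by
      rw [← norm_add_sq_real, sub_add_cancel]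
    have h2 := hT x hx
    have h3 : ‖z - x‖ ^ 2 ≤ (δ / 2) ^ 2 := by gcongr
    have h4 : ‖x‖ ^ 2 ≤ 1 := pow_le_one₀ (norm_nonneg _) h2
    nlinarith
  have hkey : (T.card : ENNReal) * μ (ball (0 : F) (δ / 2)) ≤ 2 * μ (closedBall (0 : F) R) := by
    calc (T.card : ENNReal) * μ (ball (0 : F) (δ / 2)) = ∑ x ∈ T, μ (ball x (δ / 2)) := by
          simp [μ, Measure.addHaar_ball_center]
      _ ≤ ∑ x ∈ T, 2 * μ (H x) := Finset.sum_le_sum fun x _ => hhalf x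
      _ = 2 * μ (⋃ x ∈ T, H x) := by
          rw [measure_biUnion_finset hdisj fun x _ => hmeas x, Finset.mul_sum]
      _ ≤ _ := by gcongr
  rw [Measure.addHaar_closedBall _ _ hR0.le,
    Measure.addHaar_ball_of_pos _ _ (by positivity : 0 < δ / 2),
    ← mul_assoc, ← mul_assoc] at hkey
  have hb0 : μ (ball (0 : F) 1) ≠ 0 := (measure_ball_pos _ _ one_pos).ne'
  have hbt : μ (ball (0 : F) 1) ≠ ⊤ := measure_ball_lt_top.ne
  rw [ENNReal.mul_le_mul_iff_left hb0 hbt, ← ENNReal.ofReal_natCast,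
    ← ENNReal.ofReal_mul (by positivity),
    show (2 : ENNReal) = ENNReal.ofReal 2 by simp, ← ENNReal.ofReal_mul (by positivity),
    ENNReal.ofReal_le_ofReal_iff (by positivity)] at hkey
  set k := Module.finrank ℝ F
  have hp : 0 < (δ / 2) ^ k := by positivity
  have h5 : ((T.card : ℝ) * (δ / 2) ^ k) ^ 2 ≤ (2 * R ^ k) ^ 2 := by gcongr
  have h6 : (1 + 4 / δ ^ 2) = R ^ 2 / (δ / 2) ^ 2 := by rw [hR2]; field_simp; ring
  rw [h6, div_pow, ← mul_div_assoc, le_div_iff₀ (by positivity)]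
  rw [← pow_mul, ← pow_mul, mul_comm 2 k, pow_mul, pow_mul]
  calc (T.card : ℝ) ^ 2 * ((δ / 2) ^ k) ^ 2 = ((T.card : ℝ) * (δ / 2) ^ k) ^ 2 := by ring
    _ ≤ _ := h5
    _ = 4 * (R ^ k) ^ 2 := by rw [mul_pow]; norm_num

end Packing

/-! ### A dual form of John's theorem -/

section DualJohn

open Filter Topology

/-- The set `U` is in John position: it lies in the unit ball, and no ellipsoid
`{u | ‖B (u - u₀)‖ ≤ 1}` that contains `U` has smaller volume than the unit ball, the volume of the
ellipsoid being `|det B|⁻¹` times the volume of the ball. -/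
def InJohnPosition {k : ℕ} (U : Set (EuclideanSpace ℝ (Fin k))) : Prop :=
  (∀ u ∈ U, ‖u‖ ≤ 1) ∧
    ∀ (B : EuclideanSpace ℝ (Fin k) →ₗ[ℝ] EuclideanSpace ℝ (Fin k))
      (u₀ : EuclideanSpace ℝ (Fin k)), (∀ u ∈ U, ‖B (u - u₀)‖ ≤ 1) → |LinearMap.det B| ≤ 1

theorem det_id_add_smul_rankOne {k : ℕ} (p : EuclideanSpace ℝ (Fin k)) (c : ℝ) :
    LinearMap.det (LinearMap.id + c • (innerₛₗ ℝ p).smulRight p :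
      EuclideanSpace ℝ (Fin k) →ₗ[ℝ] EuclideanSpace ℝ (Fin k)) = 1 + c * ‖p‖ ^ 2 := by
  have h : LinearMap.id + c • (innerₛₗ ℝ p).smulRight p
      = LinearMap.transvection (c • innerₛₗ ℝ p) p := by
    ext v
    simp [LinearMap.transvection.apply, mul_assoc]
  rw [h, LinearMap.transvection.det]
  simp

theorem nonpos_of_hasDerivAt_of_le {F : ℝ → ℝ} {F' : ℝ} (hF : HasDerivAt F F' 0)
    (h : ∀ᶠ t in 𝓝[>] (0 : ℝ), F t ≤ F 0) : F' ≤ 0 := by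
  have h1 := (hasDerivWithinAt_iff_tendsto_slope' (s := Set.Ioi (0 : ℝ)) (by simp)).1
    hF.hasDerivWithinAt
  refine le_of_tendsto h1 ?_
  filter_upwards [h, self_mem_nhdsWithin] with t ht ht0
  rw [slope_def_field]
  exact div_nonpos_of_nonpos_of_nonneg (by linarith) (by simpa using (Set.mem_Ioi.1 ht0).le)

/-- John's theorem in dual form, for slabs: if the slab `|⟨p, u⟩ + q| ≤ 1` contains a set in John
position, then `‖p‖² + k q² ≤ k`. The ellipsoids `(1 - t) ‖u‖² + t (⟨p, u⟩ + q)² ≤ 1` contain the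
set, so their volume is at least that of the unit ball, and the claim is the sign of the derivative
of the volume at `t = 0`. -/
theorem InJohnPosition.norm_sq_add_le {k : ℕ} {U : Set (EuclideanSpace ℝ (Fin k))}
    (hU : InJohnPosition U) (p : EuclideanSpace ℝ (Fin k)) (q : ℝ)
    (hpq : ∀ u ∈ U, |inner ℝ p u + q| ≤ 1) : ‖p‖ ^ 2 + k * q ^ 2 ≤ k := by
  set P := ‖p‖ ^ 2 with hP
  have hP0 : 0 ≤ P := by positivity
  -- `m t` is the minimum of the quadratic function `(1 - t) ‖u‖² + t (⟨p, u⟩ + q)²`, and `F t` the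
  -- squared ratio of the volumes of the unit ball and its sublevel set at level `1`
  let m : ℝ → ℝ := fun t => t * q ^ 2 * (1 - t) / (1 - t + t * P)
  let F : ℝ → ℝ := fun t => ((1 - t) / (1 - m t)) ^ k * (1 + t * P / (1 - t))
  have hm : HasDerivAt m (q ^ 2) 0 := by
    have h := ((((hasDerivAt_id (0 : ℝ)).mul_const (q ^ 2)).mul
      ((hasDerivAt_const (0 : ℝ) (1 : ℝ)).sub (hasDerivAt_id 0)))).div
      (((hasDerivAt_const (0 : ℝ) (1 : ℝ)).sub (hasDerivAt_id 0)).add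
        ((hasDerivAt_id (0 : ℝ)).mul_const P)) (by simp)
    refine h.congr_deriv ?_
    simp
  have hm0 : m 0 = 0 := by simp [m]
  have hF : HasDerivAt F (k * (-1 + q ^ 2) + P) 0 := by
    have h := ((((hasDerivAt_const (0 : ℝ) (1 : ℝ)).sub (hasDerivAt_id 0)).div
      ((hasDerivAt_const (0 : ℝ) (1 : ℝ)).sub hm) (by simp [hm0])).pow k).mul
      ((hasDerivAt_const (0 : ℝ) (1 : ℝ)).add
        (((hasDerivAt_id (0 : ℝ)).mul_const P).div
          ((hasDerivAt_const (0 : ℝ) (1 : ℝ)).sub (hasDerivAt_id 0)) (by simp)))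
    refine h.congr_deriv ?_
    simp [hm0]
  have hF0 : F 0 = 1 := by simp [F, hm0]
  have hmcont : ContinuousAt m 0 := hm.continuousAt
  have hev : ∀ᶠ t in 𝓝[>] (0 : ℝ), m t < 1 ∧ t < 1 ∧ 0 < t := by
    have h1 : ∀ᶠ t in 𝓝 (0 : ℝ), m t < 1 := hmcont.eventually_lt continuousAt_const (by simp [hm0])
    filter_upwards [h1.filter_mono nhdsWithin_le_nhds,
      (eventually_lt_nhds (zero_lt_one' ℝ)).filter_mono nhdsWithin_le_nhds, self_mem_nhdsWithin]
      with t h1 h2 h3 using ⟨h1, h2, h3⟩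
  suffices h : k * (-1 + q ^ 2) + P ≤ 0 by linarith
  refine nonpos_of_hasDerivAt_of_le hF ?_
  filter_upwards [hev] with t ⟨hmt, ht1, ht0⟩
  rw [hF0]
  have h1t : 0 < 1 - t := by linarith
  have h1m : 0 < 1 - m t := by linarith
  have hD : 0 < 1 - t + t * P := by positivity
  have hs : 0 ≤ (1 - t) / (1 - m t) := by positivity
  have hρ : 0 < 1 + t * P / (1 - t) := by positivity
  -- the positive solution `c` of `2 c + c² P = t / (1 - t)`
  obtain ⟨c, hc⟩ : ∃ c : ℝ, 2 * c + c ^ 2 * P = t / (1 - t) := by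
    have hρ1 : 0 < 1 + √(1 + t * P / (1 - t)) := by positivity
    refine ⟨t / (1 - t) / (1 + √(1 + t * P / (1 - t))), ?_⟩
    have hsq : √(1 + t * P / (1 - t)) ^ 2 = 1 + t * P / (1 - t) := Real.sq_sqrt hρ.le
    set σ := √(1 + t * P / (1 - t))
    have hPσ : t / (1 - t) * P = σ ^ 2 - 1 := by rw [hsq]; ring
    field_simp at hPσ ⊢
    nlinarith
  let B : EuclideanSpace ℝ (Fin k) →ₗ[ℝ] EuclideanSpace ℝ (Fin k) :=
    √((1 - t) / (1 - m t)) • (LinearMap.id + c • (innerₛₗ ℝ p).smulRight p)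
  have hdet : LinearMap.det B ^ 2 = F t := by
    rw [LinearMap.det_smul, det_id_add_smul_rankOne, finrank_euclideanSpace, Fintype.card_fin,
      mul_pow, ← pow_mul, mul_comm k 2, pow_mul, Real.sq_sqrt hs]
    congr 1
    rw [mul_div_right_comm, ← hc]
    ring
  rw [← hdet, sq_le_one_iff_abs_le_one]
  refine hU.2 B (-(t * q / (1 - t + t * P)) • p) fun u hu => ?_
  rw [← sq_le_one_iff₀ (norm_nonneg _)]
  have hg : (inner ℝ p u + q) ^ 2 ≤ 1 := (sq_le_one_iff_abs_le_one _).2 (hpq u hu)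
  have hn : ‖u‖ ^ 2 ≤ 1 := pow_le_one₀ (norm_nonneg _) (hU.1 u hu)
  set a := t * q / (1 - t + t * P) with ha
  have hB : ∀ v, ‖B v‖ ^ 2 = (1 - t) / (1 - m t) * (‖v‖ ^ 2 + t / (1 - t) * inner ℝ p v ^ 2) := by
    intro v
    have : B v = √((1 - t) / (1 - m t)) • (v + (c * inner ℝ p v) • p) := by
      simp [B, smul_smul, mul_assoc]
    rw [this, norm_smul, mul_pow, Real.norm_eq_abs, sq_abs, Real.sq_sqrt hs, norm_add_sq_real,
      norm_smul, inner_smul_right, mul_pow, Real.norm_eq_abs, sq_abs, real_inner_comm, ← hP, ← hc]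
    ring
  rw [hB]
  have hv1 : ‖u - -a • p‖ ^ 2 = ‖u‖ ^ 2 + 2 * a * inner ℝ p u + a ^ 2 * P := by
    rw [neg_smul, sub_neg_eq_add, norm_add_sq_real, norm_smul, inner_smul_right, mul_pow,
      Real.norm_eq_abs, sq_abs, real_inner_comm]
    ring
  have hv2 : inner ℝ p (u - -a • p) = inner ℝ p u + a * P := by
    rw [neg_smul, sub_neg_eq_add, inner_add_right, inner_smul_right, real_inner_self_eq_norm_sq]
  rw [hv1, hv2]
  set z := inner ℝ p u
  rw [show (1 - t) / (1 - m t) * (‖u‖ ^ 2 + 2 * a * z + a ^ 2 * P + t / (1 - t) * (z + a * P) ^ 2)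
    = ((1 - t) * (‖u‖ ^ 2 + 2 * a * z + a ^ 2 * P) + t * (z + a * P) ^ 2) / (1 - m t) by
      field_simp, div_le_one h1m]
  have hexp : (1 - t) * (‖u‖ ^ 2 + 2 * a * z + a ^ 2 * P) + t * (z + a * P) ^ 2
      = (1 - t) * ‖u‖ ^ 2 + t * (z + q) ^ 2 - m t := by
    simp only [ha, m]
    field_simp
    ring
  rw [hexp]
  nlinarith

end DualJohn

/-! ### Rank bounds for systems of vectors -/

theorem sum_sum_sq_sum_mul {τ κ : Type*} [Fintype τ] [Fintype κ] (q : τ → κ → ℝ) :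
    ∑ x, ∑ y, (∑ i, q i x * q i y) ^ 2 = ∑ i, ∑ j, (∑ x, q i x * q j x) ^ 2 := by
  have h1 : ∀ x y, (∑ i, q i x * q i y) ^ 2
      = ∑ i, ∑ j, (q i x * q j x) * (q i y * q j y) := fun x y => by
    rw [sq, Finset.sum_mul_sum]
    exact Finset.sum_congr rfl fun i _ => Finset.sum_congr rfl fun j _ => by ring
  have h2 : ∀ i j, (∑ x, q i x * q j x) ^ 2
      = ∑ x, ∑ y, (q i x * q j x) * (q i y * q j y) := fun i j => by
    rw [sq, Finset.sum_mul_sum]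
  simp only [h1, h2]
  calc _ = ∑ x, ∑ i, ∑ y, ∑ j, (q i x * q j x) * (q i y * q j y) :=
        Finset.sum_congr rfl fun x _ => Finset.sum_comm
    _ = ∑ x, ∑ i, ∑ j, ∑ y, (q i x * q j x) * (q i y * q j y) :=
        Finset.sum_congr rfl fun x _ => Finset.sum_congr rfl fun i _ => Finset.sum_comm
    _ = ∑ i, ∑ x, ∑ j, ∑ y, (q i x * q j x) * (q i y * q j y) := Finset.sum_comm
    _ = _ := Finset.sum_congr rfl fun i _ => Finset.sum_comm

/-- Cauchy-Schwarz between the operator `∑ qᵢ ⊗ qᵢ` and a projection `P` that fixes all vectors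
`qᵢ`: the square of the trace is at most the rank times the squared Hilbert-Schmidt norm. -/
theorem sq_sum_sum_sq_le_of_fixed {τ κ : Type*} [Fintype τ] [Fintype κ] (q : τ → κ → ℝ)
    (P : κ → κ → ℝ) (hP : ∀ i x, ∑ y, P x y * q i y = q i x) :
    (∑ i, ∑ x, q i x * q i x) ^ 2 ≤
      (∑ x, ∑ y, P x y ^ 2) * ∑ i, ∑ j, (∑ x, q i x * q j x) ^ 2 := by
  have h1 : ∑ x, ∑ y, P x y * (∑ i, q i x * q i y) = ∑ i, ∑ x, q i x * q i x := by
    calc _ = ∑ x, ∑ i, ∑ y, q i x * (P x y * q i y) := by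
          refine Finset.sum_congr rfl fun x _ => ?_
          rw [Finset.sum_comm]
          simp only [Finset.mul_sum, mul_left_comm]
      _ = ∑ x, ∑ i, q i x * q i x := by simp only [← Finset.mul_sum, hP]
      _ = _ := Finset.sum_comm
  have hCS := Finset.sum_mul_sq_le_sq_mul_sq (Finset.univ : Finset (κ × κ))
    (fun x => P x.1 x.2) (fun x => ∑ i, q i x.1 * q i x.2)
  simp only [Fintype.sum_prod_type] at hCS
  rwa [h1, sum_sum_sq_sum_mul] at hCS

theorem sum_mul_eq_inner {n : ℕ} (u v : EuclideanSpace ℝ (Fin n)) :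
    ∑ a, u a * v a = inner ℝ u v := by
  simp [PiLp.inner_apply, mul_comm]

/-- The Gram matrix of vectors of `ℝⁿ` has rank at most `n`, which bounds its trace by its
Hilbert-Schmidt norm. -/
theorem sq_sum_norm_sq_le {n : ℕ} {τ : Type*} [Fintype τ] (u : τ → EuclideanSpace ℝ (Fin n)) :
    (∑ i, ‖u i‖ ^ 2) ^ 2 ≤ n * ∑ i, ∑ j, inner ℝ (u i) (u j) ^ 2 := by
  have h := sq_sum_sum_sq_le_of_fixed (fun i a => u i a) (fun a b => if a = b then 1 else 0)
    (by simp)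
  simpa [sum_mul_eq_inner] using h

/-- The bound of `sq_sum_sum_sq_le_of_fixed` for the matrices `u uᵀ - 1 / n` of unit vectors `u`,
which lie in the space of trace-free symmetric matrices, of dimension `(n - 1) (n + 2) / 2`. -/
theorem sq_card_mul_le_sum_inner_sq_sub {n : ℕ} (hn : 1 ≤ n) {τ : Type*} [Fintype τ]
    (u : τ → EuclideanSpace ℝ (Fin n)) (hu : ∀ i, ‖u i‖ = 1) :
    (Fintype.card τ * (1 - 1 / (n : ℝ))) ^ 2 ≤
      ((n - 1 : ℝ) * (n + 2) / 2) * ∑ i, ∑ j, (inner ℝ (u i) (u j) ^ 2 - 1 / (n : ℝ)) ^ 2 := by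
  have hn0 : (n : ℝ) ≠ 0 := by positivity
  let δ : Fin n → Fin n → ℝ := fun a b => if a = b then 1 else 0
  let Q : τ → Fin n → Fin n → ℝ := fun i a b => u i a * u i b - δ a b / n
  -- the orthogonal projection onto the trace-free symmetric matrices
  let P : Fin n → Fin n → Fin n → Fin n → ℝ := fun a b c d =>
    (δ a c * δ b d + δ a d * δ b c) / 2 - δ a b * δ c d / n
  have hnorm : ∀ i, inner ℝ (u i) (u i) = 1 := fun i => by
    rw [real_inner_self_eq_norm_sq, hu, one_pow]
  have hQQ : ∀ i j, ∑ a, ∑ b, Q i a b * Q j a b = inner ℝ (u i) (u j) ^ 2 - 1 / (n : ℝ) := by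
    intro i j
    have h1 : ∀ a b, Q i a b * Q j a b = (u i a * u j a) * (u i b * u j b)
        - δ a b * (u i a * u i b) / n - δ a b * (u j a * u j b) / n + δ a b * δ a b / n ^ 2 := by
      intro a b; simp only [Q]; field_simp; ring
    simp only [h1, Finset.sum_add_distrib, Finset.sum_sub_distrib, ← Finset.mul_sum,
      ← Finset.sum_mul, ← Finset.sum_div, sum_mul_eq_inner]
    simp only [δ, ite_mul, one_mul, zero_mul, Finset.sum_ite_eq, Finset.mem_univ, if_true,
      sum_mul_eq_inner, hnorm, Finset.sum_const, Finset.card_univ, Fintype.card_fin, nsmul_eq_mul]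
    field_simp
    ring
  have hPQ : ∀ i a b, ∑ c, ∑ d, P a b c d * Q i c d = Q i a b := by
    intro i a b
    have h1 : ∀ c d, P a b c d * Q i c d
        = (δ a c * (δ b d * Q i c d) + δ b c * (δ a d * Q i c d)) / 2
          - δ a b / n * (δ c d * Q i c d) := by
      intro c d; simp only [P]; ring
    have h2 : ∑ c, Q i c c = 0 := by
      simp only [Q, δ, if_true, Finset.sum_sub_distrib, sum_mul_eq_inner, hnorm]
      simp [hn0]
    have h3 : Q i b a = Q i a b := by simp only [Q, δ, mul_comm, eq_comm]
    simp only [h1, Finset.sum_add_distrib, Finset.sum_sub_distrib, ← Finset.mul_sum,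
      ← Finset.sum_div]
    simp only [δ, ite_mul, one_mul, zero_mul, Finset.sum_ite_eq, Finset.mem_univ, if_true, h2, h3]
    ring
  have hP : ∑ a, ∑ b, ∑ c, ∑ d, P a b c d ^ 2 = (n - 1 : ℝ) * (n + 2) / 2 := by
    have h1 : ∀ a b c d, P a b c d ^ 2 = (δ a c * δ b d + δ b c * δ a d) / 4
        + (1 / 2 - 2 / n) * (δ a b * (δ a c * δ a d)) + δ a b * δ c d / n ^ 2 := by
      intro a b c d
      have hδ : ∀ x y, δ x y ^ 2 = δ x y := fun x y => by simp only [δ]; split_ifs <;> simp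
      have e1 : δ a c * (δ b d * (δ a d * δ b c)) = δ a b * (δ a c * δ a d) := by
        simp only [δ]; split_ifs <;> simp_all
      have e2 : δ a c * (δ b d * (δ a b * δ c d)) = δ a b * (δ a c * δ a d) := by
        simp only [δ]; split_ifs <;> simp_all
      have e3 : δ b c * (δ a d * (δ a b * δ c d)) = δ a b * (δ a c * δ a d) := by
        simp only [δ]; split_ifs <;> simp_all
      have e : P a b c d ^ 2 = (δ a c ^ 2 * δ b d ^ 2 + δ b c ^ 2 * δ a d ^ 2
        + 2 * (δ a c * (δ b d * (δ a d * δ b c)))) / 4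
        - (δ a c * (δ b d * (δ a b * δ c d)) + δ b c * (δ a d * (δ a b * δ c d))) / n
        + δ a b ^ 2 * δ c d ^ 2 / n ^ 2 := by simp only [P]; ring
      rw [e, e1, e2, e3]; simp only [hδ]; ring
    simp only [h1, Finset.sum_add_distrib, ← Finset.mul_sum,
      ← Finset.sum_div]
    simp only [δ, ite_mul, one_mul, zero_mul, mul_one, Finset.sum_ite_eq,
      Finset.mem_univ, if_true, Finset.sum_const, Finset.card_univ,
      Fintype.card_fin, nsmul_eq_mul]
    field_simp
    ring
  have h := sq_sum_sum_sq_le_of_fixed (fun i (x : Fin n × Fin n) => Q i x.1 x.2)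
    (fun x y => P x.1 x.2 y.1 y.2) (fun i x => by simpa [Fintype.sum_prod_type] using hPQ i x.1 x.2)
  simp only [Fintype.sum_prod_type, hQQ, hP] at h
  simpa only [hnorm, one_pow, Finset.sum_const, Finset.card_univ, nsmul_eq_mul] using h

/-- Unit vectors of `ℝⁿ` with squared inner products at most `1 / n + η` number at most
`n (n + 2) / 2`, up to a correction that vanishes with `η`. -/
theorem card_mul_le_of_inner_sq_le {n : ℕ} (hn : 2 ≤ n) {τ : Type*} [Fintype τ]
    (u : τ → EuclideanSpace ℝ (Fin n)) (hu : ∀ i, ‖u i‖ = 1) {η : ℝ} (hη : 0 ≤ η)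
    (hηn : η ≤ 1 / n) (h : ∀ i j, i ≠ j → inner ℝ (u i) (u j) ^ 2 ≤ 1 / n + η) :
    (Fintype.card τ : ℝ) * (n - 1 - η * n * (n + 2)) ≤ n * (n - 1) * (n + 2) / 2 := by
  classical
  have hn2 : (2 : ℝ) ≤ n := by exact_mod_cast hn
  set N : ℝ := (Fintype.card τ : ℝ)
  rcases (show (0 : ℝ) ≤ N from Nat.cast_nonneg _).eq_or_lt with h0 | hN
  · rw [← h0, zero_mul]
    have : (0 : ℝ) ≤ n - 1 := by linarith
    positivity
  set ν : ℝ := 1 / n with hν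
  have hν0 : 0 < ν := by positivity
  have hnν : n * ν = 1 := by rw [hν]; field_simp
  have hν1 : ν ≤ 1 := by nlinarith
  have hself : ∀ i, inner ℝ (u i) (u i) = 1 := fun i => by
    rw [real_inner_self_eq_norm_sq, hu, one_pow]
  -- off the diagonal `-ν ≤ g - ν ≤ η ≤ ν` for the squared inner products `g`, so that
  -- `(g - ν)² ≤ ν |g - ν| ≤ ν (2 η - (g - ν))`; the sum of the `g - ν` is nonnegative
  have hpt : ∀ i j, (inner ℝ (u i) (u j) ^ 2 - ν) ^ 2 ≤
      ν * (2 * η - (inner ℝ (u i) (u j) ^ 2 - ν)) + if i = j then 1 - ν else 0 := by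
    intro i j
    split_ifs with hij
    · subst hij
      rw [hself]
      nlinarith
    · have h1 := h i j hij
      have h2 := sq_nonneg (inner ℝ (u i) (u j))
      set g := inner ℝ (u i) (u j) ^ 2
      rcases le_total ν g with h3 | h3 <;> nlinarith
  have hsum : ∑ i, ∑ j, (inner ℝ (u i) (u j) ^ 2 - ν) ^ 2 ≤ 2 * η * ν * N ^ 2 + N * (1 - ν) := by
    have h1 : N ^ 2 ≤ n * ∑ i, ∑ j, inner ℝ (u i) (u j) ^ 2 := by
      simpa [hu] using sq_sum_norm_sq_le u
    calc _ ≤ ∑ i, ∑ j, (ν * (2 * η - (inner ℝ (u i) (u j) ^ 2 - ν)) + if i = j then 1 - ν else 0) :=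
          Finset.sum_le_sum fun i _ => Finset.sum_le_sum fun j _ => hpt i j
      _ = ν * (2 * η * N ^ 2 - (∑ i, ∑ j, inner ℝ (u i) (u j) ^ 2 - ν * N ^ 2)) + N * (1 - ν) := by
          simp only [Finset.sum_add_distrib, ← Finset.mul_sum, Finset.sum_sub_distrib,
            Finset.sum_ite_eq, Finset.mem_univ, if_true, Finset.sum_const, Finset.card_univ,
            nsmul_eq_mul]
          ring
      _ ≤ _ := by
          have : ν * N ^ 2 ≤ ∑ i, ∑ j, inner ℝ (u i) (u j) ^ 2 := by
            calc ν * N ^ 2 ≤ ν * (n * ∑ i, ∑ j, inner ℝ (u i) (u j) ^ 2) := by gcongr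
              _ = _ := by rw [← mul_assoc, mul_comm ν, hnν, one_mul]
          nlinarith
  have hmain := sq_card_mul_le_sum_inner_sq_sub (by omega : 1 ≤ n) u hu
  have hn1 : (0 : ℝ) < n - 1 := by linarith
  have h2 : (N * (1 - ν)) ^ 2 ≤ ((n - 1 : ℝ) * (n + 2) / 2) * (2 * η * ν * N ^ 2 + N * (1 - ν)) :=
    hmain.trans (by gcongr)
  have hνn : 1 - ν = (n - 1) * ν := by rw [sub_mul, hnν, one_mul]
  rw [hνn] at h2
  have h3 : 0 < N * ν ^ 2 * (n - 1) := by positivity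
  refine le_of_mul_le_mul_left ?_ h3
  have h4 : N * ν ^ 2 * (n - 1) * (n * (n - 1) * (n + 2) / 2)
      = (n * ν) * (N * ν * (n - 1) * ((n - 1) * (n + 2) / 2)) := by ring
  have h5 : N * ν ^ 2 * (n - 1) * (N * (n - 1 - η * n * (n + 2)))
      = (N * ((n - 1) * ν)) ^ 2 - (n * ν) * (N * N * ν * (n - 1) * η * (n + 2)) := by ring
  rw [h4, h5, hnν]
  nlinarith

/-! ### The number of separated outliers of a set in John position -/

/-- `y` is an outlier of `U` at margin `γ`: some affine functional has absolute value at most `1`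
on `U` and the value `√(1 + γ)` at `y`. -/
def IsOutlier {F : Type*} [NormedAddCommGroup F] [InnerProductSpace ℝ F] (U : Set F) (γ : ℝ)
    (y : F) : Prop :=
  ∃ (p : F) (q : ℝ), (∀ u ∈ U, |inner ℝ p u + q| ≤ 1) ∧ inner ℝ p y + q = √(1 + γ)

/-- The Cauchy-Schwarz inequality for the vectors `(√k x, 1)` and `(√k b, t)`. -/
theorem sq_mul_inner_add_le {F : Type*} [NormedAddCommGroup F] [InnerProductSpace ℝ F] {k : ℝ}
    (hk : 0 ≤ k) (x b : F) (t : ℝ) :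
    (k * inner ℝ x b + t) ^ 2 ≤ (k * ‖x‖ ^ 2 + 1) * (k * ‖b‖ ^ 2 + t ^ 2) := by
  have h2 : (inner ℝ x b) ^ 2 ≤ ‖x‖ ^ 2 * ‖b‖ ^ 2 := by
    rw [← mul_pow]
    exact sq_le_sq' (neg_le_of_abs_le (abs_real_inner_le_norm x b)) (real_inner_le_norm x b)
  have h3 : 0 ≤ ‖b - t • x‖ ^ 2 := by positivity
  rw [norm_sub_sq_real, inner_smul_right, norm_smul, mul_pow, Real.norm_eq_abs, sq_abs,
    real_inner_comm] at h3
  have h4 := mul_nonneg hk h3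
  have h5 := mul_le_mul_of_nonneg_left h2 (sq_nonneg k)
  linarith

section John

variable {k : ℕ} {U : Set (EuclideanSpace ℝ (Fin k))} {γ : ℝ} {x y : EuclideanSpace ℝ (Fin k)}

/-- By `InJohnPosition.norm_sq_add_le` the separating functional is `√k`-Lipschitz. -/
theorem InJohnPosition.sqrt_sub_one_le_dist (hU : InJohnPosition U)
    (hy : IsOutlier (insert x U) γ y) : √(1 + γ) - 1 ≤ √k * dist x y := by
  obtain ⟨p, q, hpq, hv⟩ := hy
  have h1 := hU.norm_sq_add_le p q fun u hu => hpq u (Set.mem_insert_of_mem _ hu)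
  have h2 := (abs_le.1 (hpq x (Set.mem_insert _ _))).2
  have hp : ‖p‖ ≤ √k := Real.le_sqrt_of_sq_le (by nlinarith [sq_nonneg q, k.cast_nonneg (α := ℝ)])
  calc √(1 + γ) - 1 ≤ inner ℝ p (y - x) := by rw [inner_sub_right]; linarith
    _ ≤ ‖p‖ * ‖y - x‖ := real_inner_le_norm _ _
    _ ≤ √k * dist x y := by rw [dist_comm, dist_eq_norm]; gcongr

theorem InJohnPosition.one_add_le_of_isOutlier (hU : InJohnPosition U) (hγ : 0 ≤ 1 + γ)
    (hk : 1 ≤ k) (hy : IsOutlier U γ y) : 1 + γ ≤ k * ‖y‖ ^ 2 + 1 := by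
  obtain ⟨p, q, hpq, hv⟩ := hy
  have h1 := hU.norm_sq_add_le p q hpq
  have hk0 : (1 : ℝ) ≤ k := by exact_mod_cast hk
  have h2 := sq_mul_inner_add_le (k := k) (by positivity) y ((1 / (k : ℝ)) • p) q
  have h3 : k * inner ℝ y ((1 / (k : ℝ)) • p) + q = √(1 + γ) := by
    rw [← hv, inner_smul_right, real_inner_comm]
    field_simp
  have h4 : k * ‖(1 / (k : ℝ)) • p‖ ^ 2 + q ^ 2 = (‖p‖ ^ 2 + k * q ^ 2) / k := by
    rw [norm_smul, mul_pow, Real.norm_eq_abs, sq_abs]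
    field_simp
  rw [h3, h4, Real.sq_sqrt hγ] at h2
  exact h2.trans (mul_le_of_le_one_right (by positivity) (by rwa [div_le_one (by positivity)]))

/-- If the margin `γ` is almost `k`, the largest value it can have for an outlier in the unit ball,
then the functional that exhibits `y` as an outlier is nearly determined by `y`; hence the
inner products of `y` with the points where this functional has absolute value at most `1`
are nearly between `(-1 - √(k + 1)) / k` and `(-1 + √(k + 1)) / k`. -/
theorem InJohnPosition.abs_mul_inner_add_one_le (hU : InJohnPosition U) (hk : 1 ≤ k)
    {ε : ℝ} (hε : 0 ≤ ε) (hε1 : ε ≤ 1) (hγ : (1 - ε) * k ≤ γ) (hx : ‖x‖ ≤ 1) (hy1 : ‖y‖ ≤ 1)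
    (hy : IsOutlier (insert x U) γ y) :
    |k * inner ℝ x y + 1| ≤ √(k + 1) + (k + 1) * √(2 * ε) := by
  obtain ⟨p, q, hpq, hv⟩ := hy
  have h1 := hU.norm_sq_add_le p q fun u hu => hpq u (Set.mem_insert_of_mem _ hu)
  have hk0 : (1 : ℝ) ≤ k := by exact_mod_cast hk
  set s := √((k : ℝ) + 1)
  have hs0 : 0 < s := Real.sqrt_pos.2 (by positivity)
  have hs : s ^ 2 = k + 1 := Real.sq_sqrt (by positivity)
  set Γ := √(1 + γ)
  have hΓ0 : 0 ≤ Γ := Real.sqrt_nonneg _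
  have hΓ : Γ ^ 2 = 1 + γ := Real.sq_sqrt (by nlinarith)
  have hsΓ : (k + 1) * (1 - ε) ≤ s * Γ := by
    refine abs_le_of_sq_le_sq' ?_ (by positivity) |>.2
    rw [mul_pow s, hs, hΓ]
    have : (1 - ε) ^ 2 * (k + 1) ≤ 1 + γ := by nlinarith
    nlinarith
  -- `(√k b, t)` is the error in approximating `(√k y, 1)` by a multiple of `(p / √k, q)`
  set b := y - (s / k) • p
  set t := 1 - s * q
  have hb : k * ‖b‖ ^ 2 + t ^ 2 ≤ 2 * (k + 1) * ε := by
    have e : k * ‖b‖ ^ 2 + t ^ 2 = k * ‖y‖ ^ 2 + 1 - 2 * s * (inner ℝ p y + q)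
        + s ^ 2 * ((‖p‖ ^ 2 + k * q ^ 2) / k) := by
      simp only [b, t]
      rw [norm_sub_sq_real, inner_smul_right, norm_smul, mul_pow, Real.norm_eq_abs, sq_abs,
        real_inner_comm]
      field_simp
      ring
    have h2 : (‖p‖ ^ 2 + k * q ^ 2) / k ≤ 1 := by rwa [div_le_one (by positivity)]
    have h3 : ‖y‖ ^ 2 ≤ 1 := pow_le_one₀ (norm_nonneg _) hy1
    rw [e, hv, hs]
    nlinarith
  have hCS := sq_mul_inner_add_le (k := k) (by positivity) x b t
  have hx2 : ‖x‖ ^ 2 ≤ 1 := pow_le_one₀ (norm_nonneg _) hx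
  have hD : |k * inner ℝ x b + t| ≤ (k + 1) * √(2 * ε) := by
    refine abs_le_of_sq_le_sq ?_ (by positivity)
    rw [mul_pow, Real.sq_sqrt (by positivity)]
    calc _ ≤ _ := hCS
      _ ≤ (k + 1) * (2 * (k + 1) * ε) := by gcongr; nlinarith
      _ = _ := by ring
  have hdec : k * inner ℝ x y + 1 = s * (inner ℝ p x + q) + (k * inner ℝ x b + t) := by
    simp only [b, t]
    rw [inner_sub_right, inner_smul_right, real_inner_comm p x]
    field_simp
    ring
  rw [hdec]
  refine (abs_add_le _ _).trans (add_le_add ?_ hD)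
  rw [abs_mul, abs_of_pos hs0]
  exact mul_le_of_le_one_right hs0.le (hpq x (Set.mem_insert _ _))

/-- For a unit vector `y`, the widths `α` and `β` of a slab that contains a set in John position,
measured from the hyperplane through the origin, have product at least `1 / k`. -/
theorem InJohnPosition.norm_sq_le_of_slab (hU : InJohnPosition U) {α β : ℝ} (hαβ : 0 < α + β)
    (h : ∀ u ∈ U, -α ≤ inner ℝ u y ∧ inner ℝ u y ≤ β) : ‖y‖ ^ 2 ≤ k * (α * β) := by
  have h1 := hU.norm_sq_add_le ((2 / (α + β)) • y) ((α - β) / (α + β)) fun u hu => by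
    rw [inner_smul_left, real_inner_comm, conj_trivial, div_mul_eq_mul_div, ← add_div, abs_div,
      abs_of_pos hαβ, div_le_one hαβ, abs_le]
    constructor <;> linarith [h u hu]
  rw [norm_smul, mul_pow, Real.norm_eq_abs, sq_abs, div_pow, div_pow, div_mul_eq_mul_div,
    ← mul_div_assoc, ← add_div, div_le_iff₀ (by positivity)] at h1
  linarith

end John

theorem four_mul_pow_le {k : ℕ} (hk : 15 ≤ k) : 4 * (3.54 : ℝ) ^ k ≤ 4 ^ k := by
  induction k, hk using Nat.le_induction with
  | base => norm_num
  | succ k _ ih => rw [pow_succ, pow_succ]; nlinarith [pow_pos (by norm_num : (0:ℝ) < 3.54) k]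

/-- The lift `(1, √k x)` of a point `x ∈ ℝᵏ` to `ℝᵏ⁺¹`. -/
noncomputable def sqrtLift {k : ℕ} (x : EuclideanSpace ℝ (Fin k)) :
    EuclideanSpace ℝ (Fin (k + 1)) :=
  WithLp.toLp 2 (Fin.cons 1 fun i => √k * x i)

theorem inner_sqrtLift {k : ℕ} (x y : EuclideanSpace ℝ (Fin k)) :
    inner ℝ (sqrtLift x) (sqrtLift y) = k * inner ℝ x y + 1 := by
  have hk : √(k : ℝ) * √(k : ℝ) = k := Real.mul_self_sqrt (by positivity)
  rw [← sum_mul_eq_inner, ← sum_mul_eq_inner, Fin.sum_univ_succ, Finset.mul_sum, add_comm]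
  simp only [sqrtLift, Fin.cons_zero, Fin.cons_succ, mul_one]
  congr 1
  exact Finset.sum_congr rfl fun i _ => by linear_combination (x i * y i) * hk

theorem inner_single_sqrtLift {k : ℕ} (x : EuclideanSpace ℝ (Fin k)) :
    inner ℝ (EuclideanSpace.single 0 1) (sqrtLift x) = (1 : ℝ) := by
  simp [sqrtLift, EuclideanSpace.inner_single_left]

section NearExtremal

variable {k : ℕ} {T : Finset (EuclideanSpace ℝ (Fin k))}

/-- In high dimension the inner products are at most about `1 / 5`, hence the squared distances at
least `1.58`, and `1 + 4 / 1.58 < 3.54 < 4`. -/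
theorem card_le_of_nearExtremal_of_fifteen_le (hk : 15 ≤ k) (hT : ∀ x ∈ T, ‖x‖ ≤ 1)
    (hT' : ∀ x ∈ T, 1 - 1 / 1000000 ≤ ‖x‖ ^ 2)
    (hsep : ∀ x ∈ T, ∀ y ∈ T, x ≠ y →
      |k * inner ℝ x y + 1| ≤ √(k + 1 : ℝ) + (k + 1) * (1 / 1000)) :
    (T.card : ℝ) ≤ 2 ^ k := by
  have hk0 : (15 : ℝ) ≤ k := by exact_mod_cast hk
  have h1 := card_sq_le_of_separated (δ := √1.58) (by norm_num) T hT fun x hx y hy hxy => by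
    rw [dist_eq_norm]
    refine Real.sqrt_le_iff.2 ⟨norm_nonneg _, ?_⟩
    rw [norm_sub_sq_real]
    have h2 := (abs_le.1 (hsep x hx y hy hxy)).2
    have hs : √(k + 1 : ℝ) ^ 2 = k + 1 := Real.sq_sqrt (by positivity)
    have hs4 : 4 ≤ √(k + 1 : ℝ) := Real.le_sqrt_of_sq_le (by linarith)
    set s := √(k + 1 : ℝ)
    have h3 := hT' x hx
    have h4 := hT' y hy
    have h5 : k * inner ℝ x y ≤ k * 0.2026 := by nlinarith
    have h6 := le_of_mul_le_mul_left h5 (by linarith)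
    linarith
  rw [finrank_euclideanSpace_fin, Real.sq_sqrt (by norm_num)] at h1
  refine abs_le_of_sq_le_sq' ?_ (by positivity) |>.2
  calc (T.card : ℝ) ^ 2 ≤ _ := h1
    _ ≤ 4 * 3.54 ^ k := by gcongr; norm_num
    _ ≤ 4 ^ k := four_mul_pow_le hk
    _ = (2 ^ k) ^ 2 := by rw [← pow_mul, mul_comm, pow_mul]; norm_num

/-- In medium dimension `n - 1 = k` the lifted points, together with the first basis vector, are
`N + 1` unit vectors of `ℝⁿ` with squared inner products at most `1 / n + 1 / 1000`. -/
theorem card_le_of_nearExtremal_of_le_fourteen (hk : 4 ≤ k) (hk' : k ≤ 14) (hT : ∀ x ∈ T, ‖x‖ ≤ 1)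
    (hT' : ∀ x ∈ T, 1 - 1 / 1000000 ≤ ‖x‖ ^ 2)
    (hsep : ∀ x ∈ T, ∀ y ∈ T, x ≠ y →
      |k * inner ℝ x y + 1| ≤ √(k + 1 : ℝ) + (k + 1) * (1 / 1000)) :
    (T.card : ℝ) ≤ 2 ^ k := by
  have hk0 : (4 : ℝ) ≤ k := by exact_mod_cast hk
  have hkt : (k : ℝ) ≤ 14 := by exact_mod_cast hk'
  set n : ℝ := k + 1 with hn
  set s := √n
  have hs : s ^ 2 = n := Real.sq_sqrt (by positivity)
  have hs2 : 2.23 ≤ s := Real.le_sqrt_of_sq_le (by linarith)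
  have hL : ∀ x ∈ T, n * (1 - 1 / 1000000) ≤ ‖sqrtLift x‖ ^ 2 := fun x hx => by
    rw [← real_inner_self_eq_norm_sq, inner_sqrtLift, real_inner_self_eq_norm_sq]
    nlinarith [hT' x hx]
  have hLpos : ∀ x ∈ T, 0 < ‖sqrtLift x‖ := fun x hx =>
    (norm_nonneg _).lt_of_ne fun h => by nlinarith [hL x hx]
  -- the lifts of the points, normalised, together with the first basis vector
  let w : Option T → EuclideanSpace ℝ (Fin (k + 1)) := fun o =>
    o.elim (EuclideanSpace.single 0 1) fun x => ‖sqrtLift x.1‖⁻¹ • sqrtLift x.1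
  have hw : ∀ o, ‖w o‖ = 1 := by
    rintro (_ | ⟨x, hx⟩)
    · simp [w]
    · simp [w, norm_smul, (hLpos x hx).ne']
  have hsome : ∀ x ∈ T, ((‖sqrtLift x‖⁻¹) ^ 2) ≤ 1 / n * (1 + 2 / 1000000) := fun x hx => by
    rw [inv_pow, inv_le_comm₀ (by have := hLpos x hx; positivity) (by positivity)]
    refine le_trans ?_ (hL x hx)
    rw [inv_le_comm₀ (by positivity) (by positivity)]
    rw [mul_inv, one_div n]
    gcongr
    norm_num
  have hnone : ∀ x : T, inner ℝ (w none) (w (some x)) ^ 2 ≤ 1 / ((k + 1 : ℕ) : ℝ) + 1 / 1000 := by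
    intro x
    have h1 := hsome x x.2
    have h2 : 1 / n ≤ 1 := by rw [div_le_one (by positivity)]; linarith
    simp only [w, Option.elim, inner_smul_right, inner_single_sqrtLift, mul_one]
    push_cast
    rw [← hn]
    linarith
  have key := card_mul_le_of_inner_sq_le (n := k + 1) (by omega) w hw (η := 1 / 1000) (by norm_num)
    (by push_cast; rw [div_le_div_iff₀] <;> linarith) (by
      rintro (_ | x) (_ | y) hxy
      · exact absurd rfl hxy
      · exact hnone y
      · rw [real_inner_comm]; exact hnone x
      · have hxy' : x.1 ≠ y.1 := fun h => hxy (by rw [Subtype.ext h])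
        have h1 := hsep x x.2 y y.2 hxy'
        simp only [w, Option.elim, inner_smul_right, inner_smul_left, inner_sqrtLift, conj_trivial]
        push_cast
        rw [← hn]
        have hx := hsome x x.2
        have hy := hsome y y.2
        have h2 : (k * inner ℝ x.1 y.1 + 1) ^ 2 ≤ (s + n * (1 / 1000)) ^ 2 :=
          sq_le_sq' (neg_le_of_abs_le h1) (le_of_abs_le h1)
        rw [mul_pow, mul_pow]
        calc _ ≤ (1 / n * (1 + 2 / 1000000)) *
              ((1 / n * (1 + 2 / 1000000)) * (s + n * (1 / 1000)) ^ 2) := by gcongr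
          _ = (1 + 2 / 1000000) ^ 2 * (1 / n + 2 / 1000 / s + 1 / 1000000) := by
              rw [← hs]; field_simp; ring
          _ ≤ _ := by
              have h3 : 1 / s ≤ 1 / 2.23 := by gcongr
              have h4 : 1 / n ≤ 1 / 5 := by gcongr; linarith
              have h5 : 2 / 1000 / s = 2 / 1000 * (1 / s) := by ring
              rw [h5]
              norm_num at h3 h4 ⊢
              nlinarith)
  rw [Fintype.card_option, Fintype.card_coe] at key
  by_contra hcon
  push Not at hcon
  have hcon' : 2 ^ k + 1 ≤ T.card := by
    have : 2 ^ k < T.card := by exact_mod_cast hcon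
    omega
  have hc : (2 : ℝ) ^ k + 1 ≤ (T.card : ℝ) := by exact_mod_cast hcon'
  clear_value s n
  push_cast at key
  generalize (T.card : ℝ) = N at key hc
  clear hcon hcon'
  interval_cases k <;> norm_num at key hc <;> linarith

/-- In low dimension the points of `U` have inner products at most about `1 / (√(k + 1) + 1)` with
an outlier, so by `InJohnPosition.norm_sq_le_of_slab` some point of `U` is close to the antipode of
the outlier if `k = 3`, and would have to lie outside the unit ball if `k ≤ 2`. -/
theorem card_le_of_nearExtremal_of_le_three (hk : 1 ≤ k) (hk' : k ≤ 3)
    {U : Set (EuclideanSpace ℝ (Fin k))} (hU : InJohnPosition U) (hT : ∀ x ∈ T, ‖x‖ ≤ 1)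
    (hT' : ∀ x ∈ T, 1 - 1 / 1000000 ≤ ‖x‖ ^ 2)
    (hTU : ∀ u ∈ U, ∀ y ∈ T, |k * inner ℝ u y + 1| ≤ √(k + 1 : ℝ) + (k + 1) * (1 / 1000))
    (hsep : ∀ x ∈ T, ∀ y ∈ T, x ≠ y →
      |k * inner ℝ x y + 1| ≤ √(k + 1 : ℝ) + (k + 1) * (1 / 1000)) :
    (T.card : ℝ) ≤ 2 ^ k := by
  have hlow : ∀ u ∈ U, ∀ y ∈ T, -1 ≤ inner ℝ u y := fun u hu y hy => by
    have := abs_le.1 (abs_real_inner_le_norm u y)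
    have h2 : ‖u‖ * ‖y‖ ≤ 1 := mul_le_one₀ (hU.1 u hu) (norm_nonneg _) (hT y hy)
    linarith
  obtain rfl | rfl | rfl : k = 1 ∨ k = 2 ∨ k = 3 := by omega
  · suffices h : T = ∅ by simp [h]
    refine Finset.eq_empty_of_forall_notMem fun y hy => ?_
    have h1 := hU.norm_sq_le_of_slab (α := 1) (β := 0.43) (y := y) (by norm_num) fun u hu =>
      ⟨hlow u hu y hy, by
        have h2 := (abs_le.1 (hTU u hu y hy)).2
        have h3 : √((1 : ℕ) + 1 : ℝ) ≤ 1.42 := Real.sqrt_le_iff.2 (by norm_num)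
        norm_num at h2 h3 ⊢
        linarith⟩
    have := hT' y hy
    norm_num at h1 this
    linarith
  · suffices h : T = ∅ by simp [h]
    refine Finset.eq_empty_of_forall_notMem fun y hy => ?_
    have h1 := hU.norm_sq_le_of_slab (α := 1) (β := 0.38) (y := y) (by norm_num) fun u hu =>
      ⟨hlow u hu y hy, by
        have h2 := (abs_le.1 (hTU u hu y hy)).2
        have h3 : √((2 : ℕ) + 1 : ℝ) ≤ 1.74 := Real.sqrt_le_iff.2 (by norm_num)
        norm_num at h2 h3 ⊢
        linarith⟩
    have := hT' y hy
    norm_num at h1 this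
    linarith
  · have h4 : √((3 : ℕ) + 1 : ℝ) = 2 := by
      rw [Real.sqrt_eq_iff_mul_self_eq (by positivity) (by norm_num)]; norm_num
    rw [h4] at hTU hsep
    norm_num at hTU hsep
    have hup : ∀ u ∈ U, ∀ y ∈ T, inner ℝ u y ≤ 0.335 := fun u hu y hy => by
      have h2 := (abs_le.1 (hTU u hu y hy)).2
      norm_num at h2 ⊢
      linarith
    have hpair : ∀ x ∈ T, ∀ y ∈ T, x ≠ y → inner ℝ x y ^ 2 ≤ (0.23 : ℝ) := by
      intro x hx y hy hxy
      have h2 := (abs_le.1 (hsep x hx y hy hxy)).2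
      -- `U` has a point close to `-x`
      obtain ⟨u, hu, hux⟩ : ∃ u ∈ U, inner ℝ u x < (-0.99 : ℝ) := by
        by_contra! hcon
        have h1 := hU.norm_sq_le_of_slab (α := 0.99) (β := 0.335) (y := x) (by norm_num)
          fun u hu => ⟨hcon u hu, hup u hu x hx⟩
        have := hT' x hx
        norm_num at h1 this
        linarith
      have h3 : ‖u + x‖ ≤ 0.1415 := by
        refine abs_le_of_sq_le_sq' ?_ (by norm_num) |>.2
        rw [norm_add_sq_real]
        have h5 : ‖u‖ ^ 2 ≤ 1 := pow_le_one₀ (norm_nonneg _) (hU.1 u hu)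
        have h6 : ‖x‖ ^ 2 ≤ 1 := pow_le_one₀ (norm_nonneg _) (hT x hx)
        norm_num at hux ⊢
        linarith
      have h5 : inner ℝ x y = inner ℝ (u + x) y - inner ℝ u y := by rw [inner_add_left]; ring
      have h6 := (abs_le.1 (abs_real_inner_le_norm (u + x) y)).1
      have h7 : ‖u + x‖ * ‖y‖ ≤ 0.1415 := by
        nlinarith [hT y hy, norm_nonneg y, norm_nonneg (u + x)]
      have h8 := hup u hu y hy
      have h9 : -0.4765 ≤ (inner ℝ x y : ℝ) := by
        norm_num at h7 h8 ⊢
        linarith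
      have h10 : (inner ℝ x y : ℝ) ≤ 0.4765 := by
        norm_num at h2 ⊢
        linarith
      nlinarith
    have hG := sq_sum_norm_sq_le (fun x : T => x.1)
    set N : ℝ := (T.card : ℝ)
    have hl : N * (1 - 1 / 1000000) ≤ ∑ x : T, ‖x.1‖ ^ 2 := by
      calc N * (1 - 1 / 1000000) = ∑ _x : T, (1 - 1 / 1000000 : ℝ) := by
            rw [Finset.sum_const, Finset.card_univ, Fintype.card_coe, nsmul_eq_mul]
        _ ≤ _ := Finset.sum_le_sum fun x _ => hT' x x.2
    have hr : ∑ x : T, ∑ y : T, inner ℝ x.1 y.1 ^ 2 ≤ 0.23 * N ^ 2 + 0.77 * N := by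
      classical
      calc _ ≤ ∑ x : T, ∑ y : T, ((0.23 : ℝ) + if x = y then 0.77 else 0) := by
            refine Finset.sum_le_sum fun x _ => Finset.sum_le_sum fun y _ => ?_
            split_ifs with hxy
            · subst hxy
              rw [real_inner_self_eq_norm_sq]
              have h6 : ‖x.1‖ ^ 2 ≤ 1 := pow_le_one₀ (norm_nonneg _) (hT x x.2)
              calc (‖x.1‖ ^ 2) ^ 2 ≤ 1 := pow_le_one₀ (by positivity) h6
                _ = _ := by norm_num
            · rw [add_zero]
              exact hpair x x.2 y y.2 fun h => hxy (Subtype.ext h)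
        _ = _ := by
            simp only [Finset.sum_add_distrib, Finset.sum_ite_eq, Finset.mem_univ, if_true,
              Finset.sum_const, Finset.card_univ, Fintype.card_coe, nsmul_eq_mul]
            ring
    have hN : 0 ≤ N := by positivity
    have h5 : (N * (1 - 1 / 1000000)) ^ 2 ≤ 3 * (0.23 * N ^ 2 + 0.77 * N) := by
      calc _ ≤ (∑ x : T, ‖x.1‖ ^ 2) ^ 2 := by gcongr
        _ ≤ _ := hG
        _ ≤ _ := by push_cast; gcongr
    norm_num at h5 ⊢
    by_contra! hcon
    nlinarith

end NearExtremal

/-- The bound for a margin `γ` near `k` or above. -/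
theorem card_le_two_pow_of_outliers {k : ℕ} {U : Set (EuclideanSpace ℝ (Fin k))}
    (hU : InJohnPosition U) {γ : ℝ} (hγ : (1 - 1 / 2000000) * k ≤ γ)
    {T : Finset (EuclideanSpace ℝ (Fin k))} (hT : ∀ x ∈ T, ‖x‖ ≤ 1)
    (hout : ∀ x ∈ T, IsOutlier U γ x)
    (hsep : ∀ x ∈ T, ∀ y ∈ T, x ≠ y →
      IsOutlier (insert x U) γ y ∨ IsOutlier (insert y U) γ x) :
    (T.card : ℝ) ≤ 2 ^ k := by
  rcases Nat.eq_zero_or_pos k with rfl | hk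
  · have : T.card ≤ 1 := Finset.card_le_one_of_subsingleton T
    simpa using this
  have hk0 : (1 : ℝ) ≤ k := by exact_mod_cast hk
  -- the constants are `ε = 1 / 2000000`, `2 ε = 1 / 1000000` and `√(2 ε) = 1 / 1000`
  have hτ : √(2 * (1 / 2000000 : ℝ)) = 1 / 1000 := by
    rw [Real.sqrt_eq_iff_mul_self_eq (by norm_num) (by norm_num)]; norm_num
  have hT' : ∀ x ∈ T, 1 - 1 / 1000000 ≤ ‖x‖ ^ 2 := fun x hx => by
    have h := hU.one_add_le_of_isOutlier (by linarith) hk (hout x hx)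
    have h2 : (k : ℝ) * (1 - 1 / 1000000) ≤ k * ‖x‖ ^ 2 := by linarith
    exact le_of_mul_le_mul_left h2 (by linarith)
  have hnear : ∀ {x y}, ‖x‖ ≤ 1 → ‖y‖ ≤ 1 → IsOutlier (insert x U) γ y →
      |k * inner ℝ x y + 1| ≤ √(k + 1 : ℝ) + (k + 1) * (1 / 1000) := fun hx hy h => by
    rw [← hτ]
    exact hU.abs_mul_inner_add_one_le hk (by norm_num) (by norm_num) hγ hx hy h
  have hpair : ∀ x ∈ T, ∀ y ∈ T, x ≠ y →
      |k * inner ℝ x y + 1| ≤ √(k + 1 : ℝ) + (k + 1) * (1 / 1000) := fun x hx y hy hxy => by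
    rcases hsep x hx y hy hxy with h | h
    · exact hnear (hT x hx) (hT y hy) h
    · rw [real_inner_comm]
      exact hnear (hT y hy) (hT x hx) h
  rcases le_or_gt 15 k with h15 | h15
  · exact card_le_of_nearExtremal_of_fifteen_le h15 hT hT' hpair
  rcases le_or_gt 4 k with h4 | h4
  · exact card_le_of_nearExtremal_of_le_fourteen h4 (by omega) hT hT' hpair
  · refine card_le_of_nearExtremal_of_le_three hk (by omega) hU hT hT' (fun u hu y hy => ?_) hpair
    refine hnear (hU.1 u hu) (hT y hy) ?_
    rw [Set.insert_eq_of_mem hu]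
    exact hout y hy

/-- The bound for a margin `γ` below `k` and away from it. -/
theorem card_le_pow_of_outliers {k : ℕ} (hk : 1 ≤ k) {U : Set (EuclideanSpace ℝ (Fin k))}
    (hU : InJohnPosition U) {γ : ℝ} (hγ0 : 0 < γ) (hγ : γ ≤ (1 - 1 / 2000000) * k)
    {T : Finset (EuclideanSpace ℝ (Fin k))} (hT : ∀ x ∈ T, ‖x‖ ≤ 1)
    (hsep : ∀ x ∈ T, ∀ y ∈ T, x ≠ y →
      IsOutlier (insert x U) γ y ∨ IsOutlier (insert y U) γ x) :
    1 ≤ 20000000 * (k / γ * Real.posLog (k / γ)) ∧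
      (T.card : ℝ) ≤ (20000000 * (k / γ * Real.posLog (k / γ))) ^ k := by
  have hk0 : (1 : ℝ) ≤ k := by exact_mod_cast hk
  set t := k / γ with ht
  have hkt : k = t * γ := by rw [ht]; field_simp
  have ht1 : 1 ≤ t := by rw [ht, one_le_div hγ0]; linarith
  have hinv : t⁻¹ ≤ 1 - 1 / 2000000 := by
    rw [ht, inv_div, div_le_iff₀ (by positivity)]; exact hγ
  have hlog : 1 / 2000000 ≤ Real.posLog t := by
    rw [Real.posLog_eq_log (by rwa [abs_of_nonneg (by positivity)])]
    have := Real.one_sub_inv_le_log_of_pos (by positivity : 0 < t)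
    linarith
  have hbase : 10 * t ≤ 20000000 * (t * Real.posLog t) := by nlinarith
  refine ⟨by linarith, le_trans ?_ (pow_le_pow_left₀ (by positivity) hbase k)⟩
  set Γ := √(1 + γ)
  have hΓ : Γ ^ 2 = 1 + γ := Real.sq_sqrt (by positivity)
  have hΓ1 : 1 < Γ := by rw [Real.lt_sqrt zero_le_one]; linarith
  have hδ : 0 < (Γ - 1) / √k := div_pos (by linarith) (Real.sqrt_pos.2 (by linarith))
  have h1 := card_sq_le_of_separated hδ T hT fun x hx y hy hxy => by
    rw [div_le_iff₀' (Real.sqrt_pos.2 (by linarith))]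
    rcases hsep x hx y hy hxy with h | h
    · exact hU.sqrt_sub_one_le_dist h
    · rw [dist_comm]
      exact hU.sqrt_sub_one_le_dist h
  rw [finrank_euclideanSpace_fin] at h1
  have h2 : 4 / ((Γ - 1) / √k) ^ 2 ≤ 24 * t ^ 2 := by
    rw [div_pow, Real.sq_sqrt (by positivity), div_div_eq_mul_div,
      div_le_iff₀ (pow_pos (by linarith) 2)]
    -- `Γ - 1 = γ / (Γ + 1)` and `(Γ + 1)² ≤ 2 (Γ² + 1)`
    have h3 : (Γ - 1) ^ 2 * (Γ + 1) ^ 2 = γ ^ 2 := by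
      rw [← mul_pow]; congr 1; linear_combination hΓ
    have h4 : (Γ + 1) ^ 2 ≤ 2 * (2 + γ) := by nlinarith [sq_nonneg (Γ - 1)]
    have h5 : γ ≤ k := by rw [hkt]; nlinarith
    refine le_of_mul_le_mul_right ?_ (by positivity : 0 < (Γ + 1) ^ 2)
    calc 4 * (k : ℝ) * (Γ + 1) ^ 2 ≤ 4 * k * (2 * (2 + γ)) := by gcongr
      _ ≤ 24 * k ^ 2 := by nlinarith
      _ = 24 * t ^ 2 * (Γ - 1) ^ 2 * (Γ + 1) ^ 2 := by rw [mul_assoc _ ((Γ - 1) ^ 2), h3, hkt]; ring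
  refine abs_le_of_sq_le_sq' ?_ (by positivity) |>.2
  calc (T.card : ℝ) ^ 2 ≤ _ := h1
    _ ≤ 4 ^ k * (1 + 24 * t ^ 2) ^ k := by
        gcongr
        exact le_self_pow₀ (by norm_num) (by omega)
    _ = (4 * (1 + 24 * t ^ 2)) ^ k := by rw [mul_pow]
    _ ≤ ((10 * t) ^ 2) ^ k := by gcongr; nlinarith
    _ = _ := by rw [← pow_mul, ← pow_mul, mul_comm k]

/-! ### Coordinates for the minimum-volume enclosing ellipsoid -/

section Coordinates

open MeasureTheory Metric

/-- A positive definite form is the squared Euclidean norm in suitable coordinates, the scaled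
coordinates of an eigenbasis. -/
theorem LinearMap.exists_equiv_norm_sq_eq_inner {V : Type*} [NormedAddCommGroup V]
    [InnerProductSpace ℝ V] [FiniteDimensional ℝ V] {M : V →ₗ[ℝ] V} (hM : M.IsSymmetric)
    (hpos : ∀ v : V, v ≠ 0 → 0 < inner ℝ v (M v)) :
    ∃ ψ : V ≃ₗ[ℝ] EuclideanSpace ℝ (Fin (Module.finrank ℝ V)),
      ∀ v, ‖ψ v‖ ^ 2 = inner ℝ v (M v) := by
  set b := hM.eigenvectorBasis rfl
  set e := hM.eigenvalues rfl
  have hb : ∀ i, M (b i) = e i • b i := fun i =>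
    hM.apply_eigenvectorBasis rfl i
  have he : ∀ i, 0 ≤ e i := fun i => by
    have h := hpos (b i) (b.orthonormal.ne_zero i)
    rw [hb, inner_smul_right, real_inner_self_eq_norm_sq, b.orthonormal.1 i] at h
    linarith
  let f : V →ₗ[ℝ] EuclideanSpace ℝ (Fin (Module.finrank ℝ V)) :=
    { toFun := fun v => WithLp.toLp 2 fun i => √(e i) * b.repr v i
      map_add' := fun v w => by ext i; simp [mul_add]
      map_smul' := fun r v => by ext i; simp; ring }
  have hf : ∀ v, ‖f v‖ ^ 2 = inner ℝ v (M v) := fun v => by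
    rw [EuclideanSpace.real_norm_sq_eq, ← b.sum_inner_mul_inner]
    refine Finset.sum_congr rfl fun i _ => ?_
    rw [← hM, hb, inner_smul_left, conj_trivial, real_inner_comm]
    simp only [f, LinearMap.coe_mk, AddHom.coe_mk, mul_pow, Real.sq_sqrt (he i),
      OrthonormalBasis.repr_apply_apply]
    ring
  have hinj : Function.Injective f := by
    rw [injective_iff_map_eq_zero]
    intro v hv
    by_contra hne
    have := hpos v hne
    rw [← hf, hv] at this
    simp at this
  exact ⟨f.linearEquivOfInjective hinj (by simp), hf⟩

theorem IsMVEE.nonempty {d : ℕ} {S E : Set (Pt d)} (h : IsMVEE S E) : S.Nonempty := by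
  obtain ⟨m, hm, -⟩ := h
  exact (affineSpan_nonempty ℝ).1 ⟨m, hm⟩

/-- In suitable affine coordinates of the affine hull of `S`, the minimum-volume enclosing
ellipsoid is the unit ball, and `S` is in John position. -/
theorem IsMVEE.exists_coordinates {d : ℕ} {S E : Set (Pt d)} (h : IsMVEE S E) :
    ∃ (m : Pt d) (φ : EuclideanSpace ℝ (Fin (Module.finrank ℝ (vectorSpan ℝ S))) →ₗ[ℝ] Pt d)
      (U : Set (EuclideanSpace ℝ (Fin (Module.finrank ℝ (vectorSpan ℝ S))))),
      Function.Injective φ ∧ E = (fun u => m + φ u) '' {u | ‖u‖ ≤ 1} ∧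
      S = (fun u => m + φ u) '' U ∧ InJohnPosition U := by
  rw [← direction_affineSpan]
  unfold IsMVEE at h
  generalize hV : (affineSpan ℝ S).direction = V at h ⊢
  obtain ⟨m, hm, M, ⟨hsym, hpos⟩, hE, hSE, hmin⟩ := h
  obtain ⟨ψ, hψ⟩ := LinearMap.exists_equiv_norm_sq_eq_inner hsym hpos
  have hball : centredEllipsoid V M = {v | ‖ψ v‖ ≤ 1} := by
    ext v
    change inner ℝ v (M v) ≤ 1 ↔ ‖ψ v‖ ≤ 1
    rw [← hψ, sq_le_one_iff₀ (norm_nonneg _)]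
  set g : EuclideanSpace ℝ (Fin (Module.finrank ℝ V)) → Pt d := fun u => m + (ψ.symm u : Pt d)
  have hEg : E = g '' {u | ‖u‖ ≤ 1} := by
    rw [hE, ellipsoidAt, hball]
    ext x
    constructor
    · rintro ⟨v, hv, rfl⟩
      exact ⟨ψ v, hv, by simp [g]⟩
    · rintro ⟨u, hu, rfl⟩
      exact ⟨ψ.symm u, by simpa using hu, rfl⟩
  have hinj : Function.Injective (V.subtype ∘ₗ ψ.symm.toLinearMap) :=
    V.injective_subtype.comp ψ.symm.injective
  have hginj : Function.Injective g := fun u v huv => hinj (add_left_cancel huv)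
  have hS : S = g '' (g ⁻¹' S) := by
    rw [Set.image_preimage_eq_of_subset]
    exact hSE.trans (hEg ▸ Set.image_subset_range _ _)
  refine ⟨m, V.subtype ∘ₗ ψ.symm.toLinearMap, g ⁻¹' S, hinj, hEg, hS, fun u hu => ?_,
    fun B u₀ hB => ?_⟩
  · obtain ⟨v, hv, hvu⟩ := hEg ▸ hSE hu
    rwa [← hginj hvu]
  by_cases hdet : LinearMap.det B = 0
  · simp [hdet]
  have hBinj : Function.Injective B := (LinearMap.equivOfDetNeZero B hdet).injective
  -- the ellipsoid `{u | ‖B (u - u₀)‖ ≤ 1}`, transported to the affine hull of `S`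
  set ψ' : V →ₗ[ℝ] EuclideanSpace ℝ (Fin (Module.finrank ℝ V)) := B ∘ₗ ψ.toLinearMap
  set M' : V →ₗ[ℝ] V := ψ'.adjoint ∘ₗ ψ'
  have hM' : ∀ v w, inner ℝ v (M' w) = inner ℝ (ψ' v) (ψ' w) := fun v w =>
    LinearMap.adjoint_inner_right ψ' v (ψ' w)
  have hball' : centredEllipsoid V M' = {v | ‖ψ' v‖ ≤ 1} := by
    ext v
    change inner ℝ v (M' v) ≤ 1 ↔ ‖ψ' v‖ ≤ 1
    rw [hM', real_inner_self_eq_norm_sq, sq_le_one_iff₀ (norm_nonneg _)]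
  have hvol := hmin (m + ψ.symm u₀) (by
      rw [add_comm]
      exact AffineSubspace.vadd_mem_of_mem_direction (hV ▸ (ψ.symm u₀).2) hm) M'
    ⟨fun v w => by rw [hM', real_inner_comm, hM', real_inner_comm], fun v hv => by
      rw [hM']
      exact real_inner_self_pos.2 fun h0 => hv <| ψ.injective <| hBinj <| by
        rw [map_zero, map_zero]; exact h0⟩ (by
    intro s hs
    obtain ⟨u, hu, rfl⟩ := hS ▸ hs
    refine ⟨ψ.symm u - ψ.symm u₀, ?_, by simp [g]⟩
    rw [hball']
    change ‖B (ψ (ψ.symm u - ψ.symm u₀))‖ ≤ 1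
    simpa only [← map_sub, LinearEquiv.apply_symm_apply] using hB u hu)
  -- this ellipsoid is the preimage of the minimal one under the conjugate of `B`
  set B' : V →ₗ[ℝ] V := ψ.symm.toLinearMap ∘ₗ B ∘ₗ ψ.toLinearMap
  have hdet' : LinearMap.det B' = LinearMap.det B := by
    simpa [B'] using LinearMap.det_conj B ψ.symm
  have hpre : centredEllipsoid V M' = B' ⁻¹' centredEllipsoid V M := by
    rw [hball, hball']
    ext v
    change ‖B (ψ v)‖ ≤ 1 ↔ ‖ψ (ψ.symm (B (ψ v)))‖ ≤ 1
    rw [ψ.apply_symm_apply]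
  have : (subspaceVolume V).IsAddHaarMeasure := by unfold subspaceVolume; infer_instance
  rw [hpre, Measure.addHaar_preimage_linearMap _ (by rwa [hdet']), hdet'] at hvol
  have hψc : Continuous ψ := ψ.toLinearMap.continuous_of_finiteDimensional
  have h0 : subspaceVolume V (centredEllipsoid V M) ≠ 0 := by
    refine (MeasureTheory.Measure.measure_pos_of_mem_nhds _ (x := 0) ?_).ne'
    rw [hball]
    filter_upwards [(hψc.norm.continuousAt (x := 0)).eventually_lt continuousAt_const
      (by simp : ‖ψ 0‖ < 1)] with v hv using hv.le
  have htop : subspaceVolume V (centredEllipsoid V M) ≠ ⊤ := by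
    have hc : IsCompact (centredEllipsoid V M) := by
      have h1 := (isCompact_closedBall (0 : EuclideanSpace ℝ (Fin (Module.finrank ℝ V))) 1).image
        (ψ.symm.toLinearMap.continuous_of_finiteDimensional)
      convert h1 using 1
      rw [hball]
      ext v
      constructor
      · exact fun hv => ⟨ψ v, by simpa using hv, by simp⟩
      · rintro ⟨u, hu, rfl⟩
        simpa using hu
    exact hc.measure_lt_top.ne
  by_contra! hcon
  have h1 : ENNReal.ofReal |(LinearMap.det B)⁻¹| < 1 := by
    rw [ENNReal.ofReal_lt_one, abs_inv]
    exact inv_lt_one_of_one_lt₀ hcon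
  exact absurd hvol (not_le.2 (by
    simpa using (ENNReal.mul_lt_mul_iff_left h0 htop).2 h1))

end Coordinates

/-! ### Outliers and clusters with margin -/

section Outliers

variable {F : Type*} [NormedAddCommGroup F] [InnerProductSpace ℝ F] {γ : ℝ}

theorem IsOutlier.mono {U U' : Set F} {y : F} (h : IsOutlier U γ y) (hU : U' ⊆ U) :
    IsOutlier U' γ y := by
  obtain ⟨p, q, hpq, hv⟩ := h
  exact ⟨p, q, fun u hu => hpq u (hU hu), hv⟩

theorem not_isOutlier_of_mem (hγ : 0 < γ) {U : Set F} {y : F} (hy : y ∈ U) :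
    ¬ IsOutlier U γ y := by
  rintro ⟨p, q, hpq, hv⟩
  have h1 := (abs_le.1 (hpq y hy)).2
  rw [hv, Real.sqrt_le_iff] at h1
  linarith [h1.2]

theorem IsOutlier.of_image {d k : ℕ} {m : Pt d} {φ : EuclideanSpace ℝ (Fin k) →ₗ[ℝ] Pt d}
    {U : Set (EuclideanSpace ℝ (Fin k))} {u : EuclideanSpace ℝ (Fin k)}
    (h : IsOutlier ((fun u => m + φ u) '' U) γ (m + φ u)) : IsOutlier U γ u := by
  obtain ⟨p, q, hpq, hv⟩ := h
  have e : ∀ v, inner ℝ (φ.adjoint p) v + (inner ℝ p m + q) = inner ℝ p (m + φ v) + q := fun v => by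
    rw [LinearMap.adjoint_inner_left, inner_add_right]; ring
  exact ⟨φ.adjoint p, inner ℝ p m + q, fun v hv => by rw [e]; exact hpq _ ⟨v, hv, rfl⟩,
    by rw [e]; exact hv⟩

end Outliers

open scoped MatrixOrder Matrix.Norms.L2Operator in
/-- The Cauchy-Schwarz inequality for the form of a positive semidefinite matrix. -/
theorem abs_dotProduct_mulVec_le {d : ℕ} {W : Matrix (Fin d) (Fin d) ℝ} (hW : W.PosSemidef)
    (a b : Fin d → ℝ) :
    |a ⬝ᵥ W.mulVec b| ≤ √(a ⬝ᵥ W.mulVec a) * √(b ⬝ᵥ W.mulVec b) := by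
  obtain ⟨B, rfl⟩ := CStarAlgebra.nonneg_iff_eq_star_mul_self.mp hW.nonneg
  have e : ∀ a b : Fin d → ℝ, a ⬝ᵥ (star B * B).mulVec b
      = inner ℝ (WithLp.toLp 2 (B.mulVec a)) (WithLp.toLp 2 (B.mulVec b)) := fun a b => by
    rw [← sum_mul_eq_inner, ← Matrix.mulVec_mulVec, Matrix.dotProduct_mulVec,
      Matrix.star_eq_conjTranspose, Matrix.conjTranspose_eq_transpose_of_trivial,
      Matrix.vecMul_transpose]
    rfl
  simp only [e, real_inner_self_eq_norm_sq, Real.sqrt_sq (norm_nonneg _)]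
  exact abs_real_inner_le_norm _ _

/-- A point outside a cluster with margin `γ` is an outlier of the cluster: the ellipsoidal
separation `√(1 + γ) d(x, c) < d(y, c)` is also realised by the functional `⟨x - c, W (y - c)⟩`. -/
theorem HasMargin.isOutlier {d : ℕ} {X C : Finset (Pt d)} {γ : ℝ} (h : HasMargin X C γ)
    (hC : C.Nonempty) {y : Pt d} (hy : y ∈ X) (hyC : y ∉ C) : IsOutlier (C : Set (Pt d)) γ y := by
  obtain ⟨W, c, hW, hsep⟩ := h
  set Γ := √(1 + γ)
  have hΓ : 0 ≤ Γ := Real.sqrt_nonneg _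
  have hdist : ∀ x, 0 ≤ matDist W x c := fun x => Real.sqrt_nonneg _
  set D := matDist W y c with hD
  have hD0 : 0 < D := by
    obtain ⟨x, hx⟩ := hC
    exact (mul_nonneg hΓ (hdist x)).trans_lt (hsep y hy hyC x hx)
  have hD2 : D ^ 2 = (y - c).ofLp ⬝ᵥ W.mulVec (y - c).ofLp :=
    Real.sq_sqrt (by simpa using hW.dotProduct_mulVec_nonneg (y - c).ofLp)
  set p : Pt d := WithLp.toLp 2 ((Γ / D ^ 2) • W.mulVec (y - c).ofLp) with hp
  have e : ∀ x, inner ℝ p x + -inner ℝ p c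
      = Γ / D ^ 2 * ((x - c).ofLp ⬝ᵥ W.mulVec (y - c).ofLp) := fun x => by
    rw [← sub_eq_add_neg, ← inner_sub_right, ← sum_mul_eq_inner, dotProduct, Finset.mul_sum]
    exact Finset.sum_congr rfl fun i _ => by simp [hp]; ring
  refine ⟨p, -inner ℝ p c, fun x hx => ?_, ?_⟩
  · rw [e, abs_mul, abs_of_nonneg (by positivity), div_mul_eq_mul_div, div_le_one (by positivity)]
    calc _ ≤ Γ * (matDist W x c * D) := by gcongr; exact abs_dotProduct_mulVec_le hW _ _
      _ = (Γ * matDist W x c) * D := by ring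
      _ ≤ D * D := by gcongr; exact (hsep y hy hyC x hx).le
      _ = D ^ 2 := by ring
  · rw [e, ← hD2, div_mul_cancel₀ _ (by positivity)]

/-- The bound on the number of pairwise separated outliers of `S` in its minimum-volume enclosing
ellipsoid, stated for all `r` that are at least the dimension of the affine hull of `S`, as the rank
of a cluster may exceed it. -/
theorem IsMVEE.card_outliers_le {d : ℕ} {S E : Set (Pt d)} (h : IsMVEE S E) {γ : ℝ} (hγ : 0 < γ)
    {T : Finset (Pt d)} (hTE : ∀ x ∈ T, x ∈ E) (hout : ∀ x ∈ T, IsOutlier S γ x)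
    (hsep : ∀ x ∈ T, ∀ y ∈ T, x ≠ y →
      IsOutlier (insert x S) γ y ∨ IsOutlier (insert y S) γ x)
    {r : ℕ} (hr : Module.finrank ℝ (vectorSpan ℝ S) ≤ r) :
    (T.card : ℝ) ≤ max (2 ^ r) ((20000000 * (r / γ * Real.posLog (r / γ))) ^ r) := by
  have hcoord := h.exists_coordinates
  generalize Module.finrank ℝ (vectorSpan ℝ S) = k at hcoord hr
  obtain ⟨m, φ, U, hφ, hE, hS, hU⟩ := hcoord
  set g : EuclideanSpace ℝ (Fin k) → Pt d := fun u => m + φ u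
  have hg : Function.Injective g := fun u v huv => hφ (add_left_cancel huv)
  classical
  set T' := T.preimage g hg.injOn
  have hT' : T'.card = T.card := by
    rw [← Finset.card_image_of_injective T' hg, Finset.image_preimage_of_bij]
    refine ⟨fun _ hx => hx, hg.injOn, fun x hx => ?_⟩
    obtain ⟨u, -, rfl⟩ := hE ▸ hTE x hx
    exact ⟨u, hx, rfl⟩
  have hmem : ∀ u ∈ T', g u ∈ T := fun u hu => Finset.mem_preimage.1 hu
  have hball : ∀ u ∈ T', ‖u‖ ≤ 1 := fun u hu => by
    obtain ⟨v, hv, hvu⟩ := hE ▸ hTE _ (hmem u hu)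
    rwa [← hg hvu]
  have hout' : ∀ u ∈ T', IsOutlier U γ u := fun u hu =>
    IsOutlier.of_image (m := m) (φ := φ) (by rw [← hS]; exact hout _ (hmem u hu))
  have hpull : ∀ u v, IsOutlier (insert (g u) S) γ (g v) → IsOutlier (insert u U) γ v := by
    intro u v huv
    rw [hS, ← Set.image_insert_eq] at huv
    exact IsOutlier.of_image huv
  have hsep' : ∀ u ∈ T', ∀ v ∈ T', u ≠ v →
      IsOutlier (insert u U) γ v ∨ IsOutlier (insert v U) γ u := fun u hu v hv huv =>
    (hsep _ (hmem u hu) _ (hmem v hv) (hg.ne huv)).imp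
      (hpull u v) (hpull v u)
  rw [← hT']
  rcases le_total γ ((1 - 1 / 2000000) * k) with hγk | hγk
  · have hk : 1 ≤ k := by
      by_contra! hk0
      have hk0' : (k : ℝ) = 0 := by exact_mod_cast Nat.lt_one_iff.1 hk0
      rw [hk0', mul_zero] at hγk
      linarith
    obtain ⟨h1, h2⟩ := card_le_pow_of_outliers hk hU hγ hγk hball hsep'
    refine le_max_of_le_right (h2.trans ?_)
    have hkr : (k : ℝ) / γ ≤ r / γ := by gcongr
    have hmono : 20000000 * (k / γ * Real.posLog (k / γ))
        ≤ 20000000 * (r / γ * Real.posLog (r / γ)) := by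
      have := Real.posLog_le_posLog (by positivity : 0 ≤ (k : ℝ) / γ) hkr
      have := Real.posLog_nonneg (x := (k : ℝ) / γ)
      gcongr
    exact (pow_le_pow_right₀ h1 hr).trans (pow_le_pow_left₀ (by linarith) hmono r)
  · exact le_max_of_le_left ((card_le_two_pow_of_outliers hU hγk hball hout' hsep').trans
      (pow_le_pow_right₀ (by norm_num) hr))

/-- A maximal subset of `D` whose elements are pairwise related: every element of `D` is
unrelated to one of its elements. -/
theorem Finset.exists_pairwise_maximal {α : Type*} (D : Finset α) {R : α → α → Prop}
    (hsymm : ∀ x y, R x y → R y x) (hirr : ∀ x ∈ D, ¬ R x x) :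
    ∃ T ⊆ D, (∀ x ∈ T, ∀ y ∈ T, x ≠ y → R x y) ∧ ∀ x ∈ D, ∃ t ∈ T, ¬ R x t := by
  classical
  induction D using Finset.induction_on with
  | empty => exact ⟨∅, by simp⟩
  | insert a D _ ih =>
    obtain ⟨T, hTD, hT, hmax⟩ := ih fun x hx => hirr x (Finset.mem_insert_of_mem hx)
    by_cases h : ∀ t ∈ T, R a t
    · refine ⟨insert a T, Finset.insert_subset_insert a hTD, fun x hx y hy hxy => ?_,
        fun x hx => ?_⟩
      · rcases Finset.mem_insert.1 hx with rfl | hx' <;>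
          rcases Finset.mem_insert.1 hy with rfl | hy'
        · exact absurd rfl hxy
        · exact h y hy'
        · exact hsymm _ _ (h x hx')
        · exact hT x hx' y hy' hxy
      · rcases Finset.mem_insert.1 hx with rfl | hx'
        · exact ⟨x, Finset.mem_insert_self _ _, hirr x hx⟩
        · obtain ⟨t, ht, hxt⟩ := hmax x hx'
          exact ⟨t, Finset.mem_insert_of_mem ht, hxt⟩
    · push Not at h
      refine ⟨T, hTD.trans (Finset.subset_insert _ _), hT, fun x hx => ?_⟩
      rcases Finset.mem_insert.1 hx with rfl | hx'
      · exact h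
      · exact hmax x hx'

theorem theorem2 :
    ∃ K : ℝ, 0 < K ∧
      ∀ (d : ℕ) (X : Finset (Pt d)) (γ : ℝ) (S : Finset (Pt d)), 0 < γ →
        ∃ A : QueryAlg {p : Pt d // p ∈ X} (Finset (Pt d)),
          ∀ (𝒞 : Clustering X) (C : Finset (Pt d)),
            C ∈ 𝒞.parts → S ⊆ C → HasMargin X C γ →
              ((A.result (scq X 𝒞) : Finset (Pt d)) : Set (Pt d)) =
                  (C : Set (Pt d)) ∩ mvee (S : Set (Pt d)) ∧
              (A.numQueries (scq X 𝒞) : ℝ) ≤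
                max ((2 : ℝ) ^ clusterRank C)
                  ((K * ((clusterRank C : ℝ) / γ *
                    Real.posLog ((clusterRank C : ℝ) / γ))) ^ clusterRank C) := by
  classical
  refine ⟨20000000, by norm_num, fun d X γ S hγ => ?_⟩
  by_cases hE : ∃ E, IsMVEE (S : Set (Pt d)) E
  swap
  -- without a minimum-volume ellipsoid (in fact only for `S = ∅`) the answer is the empty set
  · refine ⟨.output ∅, fun 𝒞 C _ _ _ => ⟨by simp [QueryAlg.result, mvee, dif_neg hE], ?_⟩⟩
    simp only [QueryAlg.numQueries, Nat.cast_zero]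
    positivity
  by_cases hSX : S ⊆ X
  swap
  · exact ⟨.output ∅, fun 𝒞 C hC hSC _ => absurd (hSC.trans (𝒞.le hC)) hSX⟩
  have hmvee : IsMVEE (S : Set (Pt d)) (mvee S) := by
    rw [mvee, dif_pos hE]
    exact Classical.choose_spec hE
  set E := mvee (S : Set (Pt d))
  obtain ⟨s, hs⟩ := hmvee.nonempty
  let R : {p : Pt d // p ∈ X} → {p : Pt d // p ∈ X} → Prop := fun x y =>
    IsOutlier (insert x.1 (S : Set (Pt d))) γ y.1 ∨ IsOutlier (insert y.1 (S : Set (Pt d))) γ x.1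
  obtain ⟨T, hTD, hTR, hmax⟩ := Finset.exists_pairwise_maximal
    (X.attach.filter fun x => x.1 ∈ E ∧ IsOutlier (S : Set (Pt d)) γ x.1) (R := R)
    (fun x y => Or.symm) fun x _ h => not_isOutlier_of_mem hγ (Set.mem_insert _ _) (h.elim id id)
  let out : List {p : Pt d // p ∈ X} → Finset (Pt d) := fun l =>
    (X.attach.filter fun x => x.1 ∈ E ∧
      (IsOutlier (S : Set (Pt d)) γ x.1 → ∃ t ∈ l, ¬ R x t)).image Subtype.val
  refine ⟨.askAll ⟨s, hSX hs⟩ T.toList out, fun 𝒞 C hC hSC hmargin => ⟨?_, ?_⟩⟩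
  · rw [QueryAlg.result_askAll]
    have hCX : C ⊆ X := 𝒞.le hC
    have hCne : C.Nonempty := ⟨s, hSC hs⟩
    have hfilter : ∀ t, t ∈ T.toList.filter (scq X 𝒞 ⟨s, hSX hs⟩) ↔ t ∈ T ∧ t.1 ∈ C := fun t => by
      rw [List.mem_filter, Finset.mem_toList, scq_eq_true_iff hC (hSC hs)]
    -- a point in the cluster and a point outside it are related
    have hR : ∀ {x y : {p : Pt d // p ∈ X}}, x.1 ∈ C → y.1 ∉ C →
        IsOutlier (insert x.1 (S : Set (Pt d))) γ y.1 := fun {x y} hx hy =>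
      (hmargin.isOutlier hCne y.2 hy).mono (Set.insert_subset hx (by exact_mod_cast hSC))
    ext x
    simp only [out, Finset.coe_image, Set.mem_image, Finset.mem_coe, Finset.mem_filter,
      Finset.mem_attach, true_and, Set.mem_inter_iff, hfilter]
    constructor
    · rintro ⟨x, ⟨hxE, hx⟩, rfl⟩
      refine ⟨?_, hxE⟩
      by_contra hxC
      obtain ⟨t, ⟨-, htC⟩, hxt⟩ :=
        hx ((hmargin.isOutlier hCne x.2 hxC).mono (by exact_mod_cast hSC))
      exact hxt (Or.inr (hR htC hxC))
    · rintro ⟨hxC, hxE⟩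
      refine ⟨⟨x, hCX hxC⟩, ⟨hxE, fun hxout => ?_⟩, rfl⟩
      obtain ⟨t, ht, hxt⟩ := hmax ⟨x, hCX hxC⟩ (by simp [hxE, hxout])
      exact ⟨t, ⟨ht, by_contra fun htC => hxt (Or.inl (hR hxC htC))⟩, hxt⟩
  · rw [QueryAlg.numQueries_askAll, Finset.length_toList, ← Finset.card_image_of_injective T
      Subtype.val_injective]
    refine hmvee.card_outliers_le hγ ?_ ?_ ?_ ?_
    · intro x hx
      obtain ⟨t, ht, rfl⟩ := Finset.mem_image.1 hx
      exact (Finset.mem_filter.1 (hTD ht)).2.1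
    · intro x hx
      obtain ⟨t, ht, rfl⟩ := Finset.mem_image.1 hx
      exact (Finset.mem_filter.1 (hTD ht)).2.2
    · intro x hx y hy hxy
      obtain ⟨t, ht, rfl⟩ := Finset.mem_image.1 hx
      obtain ⟨t', ht', rfl⟩ := Finset.mem_image.1 hy
      exact hTR t ht t' ht' fun h => hxy (by rw [h])
    · refine Submodule.finrank_mono ?_
      calc vectorSpan ℝ (S : Set (Pt d)) ≤ Submodule.span ℝ (S : Set (Pt d)) := by
            refine Submodule.span_le.2 ?_
            rintro _ ⟨a, ha, b, hb, rfl⟩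
            exact Submodule.sub_mem _ (Submodule.subset_span ha) (Submodule.subset_span hb)
        _ ≤ _ := Submodule.span_mono (by exact_mod_cast hSC)
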